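/- Let $G$ be a finite group. For a category $\mathscr{C}$ with finite limits and given classes of weak equivalences, cofibrations and fibrations, let $G\mathscr{C}=[BG,\mathscr{C}]$ be the category of $G$-objects in $\mathscr{C}$, and for $H\le G$ let $X^H$ denote the $H$-fixed points, i.e. the limit over $BH$ of $X$ restricted to $H$. A map $f$ in $G\mathscr{C}$ is an *underlying cofibration* (resp. *naive weak equivalence*, *naive fibration*) if its underlying map in $\mathscr{C}$ is a cofibration (resp. weak equivalence, fibration); a *naive cofibration* if it has the left lifting property with respect to the maps that are both naive weak equivalences and naive fibrations; a *genuine weak equivalence* (resp. *genuine fibration*) if $f^H$ is a weak equivalence (resp. fibration) in $\mathscr{C}$ for every subgroup $H\le G$; a *genuine cofibration* if it has the left lifting property with respect to the maps that are both genuine weak equivalences and genuine fibrations; a *blended fibration* if it has the right lifting property with respect to the maps that are both naive weak equivalences and genuine cofibrations. Let $\mathrm{sSet}_*$ be the category of based simplicial sets, with the Kan--Quillen model structure (all classes detected on underlying simplicial sets). Let $\mathrm{s}\mathbb{Q}\text{-mod}$ be the category of simplicial $\mathbb{Q}$-modules, with weak equivalences and fibrations those of underlying simplicial sets, and cofibrations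 the maps with the left lifting property with respect to acyclic fibrations. Let $\mathrm{Ch}_{\mathbb{Q}}^+$ be the category of non-negatively graded chain complexes of $\mathbb{Q}$-modules with the projective model structure: weak equivalences the quasi-isomorphisms, fibrations the maps surjective in positive degrees, and cofibrations the maps with the left lifting property with respect to acyclic fibrations. 1. A map in $G\mathrm{sSet}_*$ is an underlying cofibration if and only if it is a genuine cofibration. 2. For $\mathscr{C}=\mathrm{s}\mathbb{Q}\text{-mod}$ and $\mathscr{C}=\mathrm{Ch}_{\mathbb{Q}}^+$, a map in $G\mathscr{C}$ is an underlying cofibration if and only if it is a naive cofibration if and only if it is a genuine cofibration. 3. For $\mathscr{C}=\mathrm{s}\mathbb{Q}\text{-mod}$ and $\mathscr{C}=\mathrm{Ch}_{\mathbb{Q}}^+$, the following three choices of classes in $G\mathscr{C}$ coincide and form a model structure: the blended one (naive weak equivalences, genuine cofibrations, blended fibrations); the injective one (naive weak equivalences, underlying cofibrations, and as fibrations the maps with the right lifting property with respect to the maps that are both naive weak equivalences and underlying cofibrations); and the naive one (naive weak equivalences, naive cofibrations, naive fibrations). -/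

import Mathlib

open CategoryTheory Limits HomotopicalAlgebra

universe w v' u' u

/-! ### Classes of weak equivalences, cofibrations and fibrations -/

/-- Three classes of morphisms of a category, called weak equivalences, cofibrations and
fibrations. No axiom is imposed; see `ModelClasses.IsModelStructure`. -/
@[ext]
structure ModelClasses (C : Type u') [Category.{v'} C] where
  /-- the weak equivalences -/
  weq : MorphismProperty C
  /-- the cofibrations -/
  cof : MorphismProperty C
  /-- the fibrations -/
  fib : MorphismProperty C

namespace ModelClasses

section

variable {C : Type u'} [Category.{v'} C]

/-- The three classes satisfy the axioms of a (Quillen) model category. -/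
def IsModelStructure (M : ModelClasses C) : Prop :=
  ∃ m : ModelCategory C,
    m.categoryWithWeakEquivalences.weakEquivalences = M.weq ∧
    m.categoryWithCofibrations.cofibrations = M.cof ∧
    m.categoryWithFibrations.fibrations = M.fib

end

end ModelClasses

/-! ### The three base categories with their standard model structures -/

/-- The Kan-Quillen model structure on simplicial sets, the one whose cofibrations are the
monomorphisms and whose fibrations are the Kan fibrations (right lifting property with respect to
the horn inclusions). As in any model structure, the weak equivalences are then the composites of
a map with the left lifting property with respect to all fibrations (an anodyne extension)
followed by a map with the right lifting property with respect to all cofibrations. -/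
def kanQuillen : ModelClasses SSet.{u} where
  weq := fun X Y f => ∃ (Z : SSet.{u}) (i : X ⟶ Z) (p : Z ⟶ Y),
    (SSet.modelCategoryQuillen.J.{u}).rlp.llp i ∧
    (MorphismProperty.monomorphisms SSet.{u}).rlp p ∧ i ≫ p = f
  cof := MorphismProperty.monomorphisms SSet.{u}
  fib := (SSet.modelCategoryQuillen.J.{u}).rlp

/-- Based simplicial sets: simplicial sets under the point `Δ[0]`. -/
abbrev PointedSSet : Type (u + 1) := Under (SSet.stdSimplex.{u}.obj (SimplexCategory.mk 0))

/-- The standard model structure on based simplicial sets: all classes are detected on underlying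
simplicial sets. -/
def pointedSSetModel : ModelClasses PointedSSet.{u} where
  weq := (kanQuillen.{u}).weq.inverseImage (Under.forget _)
  cof := (kanQuillen.{u}).cof.inverseImage (Under.forget _)
  fib := (kanQuillen.{u}).fib.inverseImage (Under.forget _)

/-- Simplicial `ℚ`-modules. -/
abbrev SimplicialQMod : Type (u + 1) := SimplicialObject (ModuleCat.{u} ℚ)

/-- The underlying simplicial set of a simplicial `ℚ`-module. -/
noncomputable def SimplicialQMod.toSSet : SimplicialQMod.{u} ⥤ SSet.{u} :=
  (SimplicialObject.whiskering _ _).obj (forget (ModuleCat.{u} ℚ))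

/-- The standard model structure on simplicial `ℚ`-modules: weak equivalences and fibrations are
those of the underlying simplicial sets, and cofibrations are determined by the left lifting
property with respect to the acyclic fibrations. -/
noncomputable def simplicialQModModel : ModelClasses SimplicialQMod.{u} where
  weq := (kanQuillen.{u}).weq.inverseImage SimplicialQMod.toSSet
  cof := ((kanQuillen.{u}).weq.inverseImage SimplicialQMod.toSSet ⊓
    (kanQuillen.{u}).fib.inverseImage SimplicialQMod.toSSet).llp
  fib := (kanQuillen.{u}).fib.inverseImage SimplicialQMod.toSSet

/-- Non-negatively graded chain complexes of `ℚ`-modules. -/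
abbrev ChQ : Type (u + 1) := ChainComplex (ModuleCat.{u} ℚ) ℕ

/-- The morphisms of `ChQ` that are surjective in every positive degree. -/
def ChQ.posSurj : MorphismProperty ChQ.{u} :=
  fun _ _ f => ∀ n : ℕ, 0 < n → Function.Surjective (f.f n)

/-- The projective model structure on non-negatively graded rational chain complexes: weak
equivalences are quasi-isomorphisms, fibrations are surjective in positive degrees, and
cofibrations are determined by the left lifting property with respect to the acyclic
fibrations. -/
noncomputable def chQModel : ModelClasses ChQ.{u} where
  weq := HomologicalComplex.quasiIso (ModuleCat.{u} ℚ) (ComplexShape.down ℕ)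
  cof := (HomologicalComplex.quasiIso (ModuleCat.{u} ℚ) (ComplexShape.down ℕ) ⊓ ChQ.posSurj).llp
  fib := ChQ.posSurj

/-! ### Objects with an action of a finite group -/

/-- The category of `G`-objects of `C`: functors to `C` from the one-object category `BG`. -/
abbrev GObj (G : Type w) [Group G] (C : Type u') [Category.{v'} C] := SingleObj G ⥤ C

/-- A category with finite limits has limits indexed by `BG`, for a finite group `G` in any
universe. -/
instance hasLimitsOfShape_singleObj (G : Type w) [Group G] [Finite G]
    (C : Type u') [Category.{v'} C] [HasFiniteLimits C] :
    HasLimitsOfShape (SingleObj G) C := by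
  let _ : Fintype (Shrink.{0} G) := Fintype.ofFinite _
  exact hasLimitsOfShape_of_equivalence
    (MulEquiv.toSingleObjEquiv (Shrink.mulEquiv.{0} (α := G)))

namespace GObj

variable (G : Type w) [Group G] (C : Type u') [Category.{v'} C]

/-- The underlying object of a `G`-object. -/
def underlying : GObj G C ⥤ C := (evaluation (SingleObj G) C).obj (SingleObj.star G)

variable {G} in
/-- The `H`-fixed points `X ↦ X^H`: restrict the action along `H ≤ G`, then take the limit
over `BH`. -/
noncomputable def fixedPoints [Finite G] [HasFiniteLimits C] (H : Subgroup G) : GObj G C ⥤ C :=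
  (Functor.whiskeringLeft (SingleObj H) (SingleObj G) C).obj H.subtype.toFunctor ⋙ lim

end GObj

namespace ModelClasses

section

variable {C : Type u'} [Category.{v'} C] (M : ModelClasses C) (G : Type w) [Group G]

/-- Underlying cofibrations of `G`-objects. -/
def underlyingCof : MorphismProperty (GObj G C) := M.cof.inverseImage (GObj.underlying G C)

/-- Naive weak equivalences: the underlying morphism is a weak equivalence. -/
def naiveWeq : MorphismProperty (GObj G C) := M.weq.inverseImage (GObj.underlying G C)

/-- Naive fibrations: the underlying morphism is a fibration. -/
def naiveFib : MorphismProperty (GObj G C) := M.fib.inverseImage (GObj.underlying G C)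

/-- Naive cofibrations: left lifting property with respect to the naive acyclic fibrations. -/
def naiveCof : MorphismProperty (GObj G C) := (M.naiveWeq G ⊓ M.naiveFib G).llp

/-- The naive model structure: underlying weak equivalences and underlying fibrations. -/
def naive : ModelClasses (GObj G C) where
  weq := M.naiveWeq G
  cof := M.naiveCof G
  fib := M.naiveFib G

/-- The injective model structure: underlying weak equivalences and underlying cofibrations. -/
def injective : ModelClasses (GObj G C) where
  weq := M.naiveWeq G
  cof := M.underlyingCof G
  fib := (M.naiveWeq G ⊓ M.underlyingCof G).rlp

variable [Finite G] [HasFiniteLimits C]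

/-- Genuine weak equivalences: `f^H` is a weak equivalence for every subgroup `H` of `G`. -/
def genuineWeq : MorphismProperty (GObj G C) :=
  fun _ _ f => ∀ H : Subgroup G, M.weq ((GObj.fixedPoints C H).map f)

/-- Genuine fibrations: `f^H` is a fibration for every subgroup `H` of `G`. -/
def genuineFib : MorphismProperty (GObj G C) :=
  fun _ _ f => ∀ H : Subgroup G, M.fib ((GObj.fixedPoints C H).map f)

/-- Genuine cofibrations: left lifting property with respect to the genuine acyclic
fibrations. -/
def genuineCof : MorphismProperty (GObj G C) := (M.genuineWeq G ⊓ M.genuineFib G).llp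

/-- Blended fibrations: right lifting property with respect to the maps that are both naive weak
equivalences and genuine cofibrations. -/
def blendedFib : MorphismProperty (GObj G C) := (M.naiveWeq G ⊓ M.genuineCof G).rlp

/-- The blended model structure: naive weak equivalences, genuine cofibrations and blended
fibrations. -/
def blended : ModelClasses (GObj G C) where
  weq := M.naiveWeq G
  cof := M.genuineCof G
  fib := M.blendedFib G

end

end ModelClasses

/-! Rational cases. In a `ℚ`-linear category, a lift of underlying maps can be averaged over `G`
into an equivariant lift (`hasLiftingProperty_of_underlying`). Hence, for a model structure with
functorial factorizations, the underlying weak equivalences, cofibrations and fibrations form a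
model structure on `G`-objects (`IsFunctorialModel.gObj`): functoriality carries the action to the
factorizations. Since cofibrations are determined by lifting, underlying and naive cofibrations
agree. Averaging also makes `f^H` a retract of the underlying map, and the trivial subgroup recovers
that map; so naive and genuine weak equivalences and fibrations agree, and with them the
cofibrations. The coincidence of the three structures follows formally.

It remains to provide such structures on the two base categories. For chain complexes, cones give
both factorizations, and monomorphisms lift against acyclic fibrations because acyclic rational
complexes are injective objects. For simplicial modules, this structure is transported along the
Dold-Kan equivalence and compared with the classes defined through simplicial sets. Fibrations are
compared by Moore's horn-filling algorithm. Weak equivalences are compared through the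
free-forgetful adjunction: the counit has a natural section on normalized chains, not additive but
compatible with differentials, which exhibits the homology of `X` as a retract of that of the free
module on `X`.

Based simplicial sets. A genuine acyclic fibration is a map whose fixed points all lift against
monomorphisms. Genuine cofibrations are injective because they lift against the contractible objects
coinduced from sets of simplices. Conversely, an equivariant injection lifts against a genuine
acyclic fibration by a Zorn argument, adding the orbit of one nondegenerate simplex `y` at a time;
the lifting problem for that orbit is a boundary-filling problem in the fixed points of the
stabilizer of `y`. -/

namespace GObj

/-! ### Actions and fixed points in terms of the underlying object. -/

section Action

variable {G : Type w} [Group G] {C : Type u'} [Category.{v'} C]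

/-- The action of an element of the group on the underlying object. -/
def act (X : GObj G C) (g : G) : (underlying G C).obj X ⟶ (underlying G C).obj X :=
  X.map (X := SingleObj.star G) (Y := SingleObj.star G) g

lemma act_one (X : GObj G C) : act X 1 = 𝟙 _ := X.map_id _

lemma act_mul (X : GObj G C) (g h : G) : act X (g * h) = act X h ≫ act X g :=
  X.map_comp (X := SingleObj.star G) (Y := SingleObj.star G) (Z := SingleObj.star G) h g

lemma act_mul_assoc (X : GObj G C) (g h : G) {Z : C} (k : (underlying G C).obj X ⟶ Z) :
    act X (g * h) ≫ k = act X h ≫ act X g ≫ k := by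
  rw [act_mul, Category.assoc]

lemma act_inv_act (X : GObj G C) (g : G) : act X g⁻¹ ≫ act X g = 𝟙 _ := by
  rw [← act_mul, mul_inv_cancel, act_one]

lemma act_inv_act_assoc (X : GObj G C) (g : G) {Z : C} (k : (underlying G C).obj X ⟶ Z) :
    act X g⁻¹ ≫ act X g ≫ k = k := by
  rw [← Category.assoc, act_inv_act, Category.id_comp]

lemma act_naturality {X Y : GObj G C} (f : X ⟶ Y) (g : G) :
    act X g ≫ (underlying G C).map f = (underlying G C).map f ≫ act Y g :=
  f.naturality (X := SingleObj.star G) (Y := SingleObj.star G) g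

lemma act_naturality_assoc {X Y : GObj G C} (f : X ⟶ Y) (g : G) {Z : C}
    (k : (underlying G C).obj Y ⟶ Z) :
    act X g ≫ (underlying G C).map f ≫ k = (underlying G C).map f ≫ act Y g ≫ k := by
  rw [← Category.assoc, act_naturality, Category.assoc]

/-- A morphism of `G`-objects from an equivariant morphism of the underlying objects. -/
def homMk {X Y : GObj G C} (φ : (underlying G C).obj X ⟶ (underlying G C).obj Y)
    (hφ : ∀ g : G, act X g ≫ φ = φ ≫ act Y g) : X ⟶ Y :=
  SingleObj.natTrans φ hφ

@[simp]
lemma underlying_map_homMk {X Y : GObj G C} (φ : (underlying G C).obj X ⟶ (underlying G C).obj Y)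
    (hφ : ∀ g : G, act X g ≫ φ = φ ≫ act Y g) : (underlying G C).map (homMk φ hφ) = φ := rfl

instance : (underlying G C).Faithful where
  map_injective h := NatTrans.ext (funext fun _ ↦ h)

section

variable [Finite G] [HasFiniteLimits C] (H : Subgroup G)

/-- The inclusion of the fixed points. -/
noncomputable def fixedPointsι (X : GObj G C) :
    (fixedPoints C H).obj X ⟶ (underlying G C).obj X :=
  limit.π (H.subtype.toFunctor ⋙ X) (SingleObj.star H)

lemma fixedPointsι_naturality {X Y : GObj G C} (f : X ⟶ Y) :
    (fixedPoints C H).map f ≫ fixedPointsι H Y = fixedPointsι H X ≫ (underlying G C).map f :=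
  limMap_π _ _

lemma fixedPointsι_act (X : GObj G C) (h : H) :
    fixedPointsι H X ≫ act X (h : G) = fixedPointsι H X :=
  limit.w (H.subtype.toFunctor ⋙ X) (j := SingleObj.star H) (j' := SingleObj.star H) h

lemma fixedPoints_hom_ext {X : GObj G C} {Z : C} {a b : Z ⟶ (fixedPoints C H).obj X}
    (h : a ≫ fixedPointsι H X = b ≫ fixedPointsι H X) : a = b :=
  limit.hom_ext (fun _ ↦ h)

/-- The cone over the restriction to `H` given by an `H`-invariant morphism. -/
def invariantCone {X : GObj G C} {Z : C} (t : Z ⟶ (underlying G C).obj X)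
    (ht : ∀ h : H, t ≫ act X (h : G) = t) : Cone (H.subtype.toFunctor ⋙ X) where
  pt := Z
  π := SingleObj.natTrans t (fun h ↦ (Category.id_comp t).trans (ht h).symm)

/-- An `H`-invariant morphism factors through the fixed points. -/
noncomputable def fixedPointsLift {X : GObj G C} {Z : C} (t : Z ⟶ (underlying G C).obj X)
    (ht : ∀ h : H, t ≫ act X (h : G) = t) : Z ⟶ (fixedPoints C H).obj X :=
  limit.lift _ (invariantCone H t ht)

@[simp]
lemma fixedPointsLift_ι {X : GObj G C} {Z : C} (t : Z ⟶ (underlying G C).obj X)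
    (ht : ∀ h : H, t ≫ act X (h : G) = t) : fixedPointsLift H t ht ≫ fixedPointsι H X = t :=
  limit.lift_π _ _

end

end Action

/-! ### Averaging over a finite group in `ℚ`-linear categories. -/

section Averaging

variable {G : Type w} [Group G] {C : Type u'} [Category.{v'} C] [Preadditive C] [Linear ℚ C]

lemma inv_card_smul_sum_const (K : Type*) [Fintype K] [Nonempty K] {X Y : C} (χ : X ⟶ Y) :
    (Nat.card K : ℚ)⁻¹ • ∑ _k : K, χ = χ := by
  rw [Finset.sum_const, Finset.card_univ, ← Nat.card_eq_fintype_card, ← Nat.cast_smul_eq_nsmul ℚ,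
    smul_smul, inv_mul_cancel₀ (by simp), one_smul]

/-- Over `ℚ`, lifting properties of `G`-maps can be checked on underlying maps, by averaging. -/
lemma hasLiftingProperty_of_underlying [Finite G] {A B X Y : GObj G C} (i : A ⟶ B) (p : X ⟶ Y)
    [HasLiftingProperty ((underlying G C).map i) ((underlying G C).map p)] :
    HasLiftingProperty i p where
  sq_hasLift {f g} sq := by
    have := Fintype.ofFinite G
    have sq' := sq.map (underlying G C)
    -- Each conjugate of the underlying lift is again a lift, the square being equivariant, so their
    -- mean is one too; translating the index of the sum shows that the mean is equivariant.
    refine ⟨⟨⟨homMk ((Nat.card G : ℚ)⁻¹ • ∑ g : G, act B g⁻¹ ≫ sq'.lift ≫ act X g) (fun a ↦ ?_),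
      ?_, ?_⟩⟩⟩
    · rw [Linear.comp_smul, Linear.smul_comp, Preadditive.comp_sum, Preadditive.sum_comp]
      congr 1
      refine (Fintype.sum_equiv (Equiv.mulLeft a) _ _ (fun g ↦ ?_)).symm
      rw [Equiv.coe_mulLeft, Category.assoc, Category.assoc, ← act_mul, ← act_mul_assoc,
        mul_inv_rev, inv_mul_cancel_right]
    · apply (underlying G C).map_injective
      rw [Functor.map_comp, underlying_map_homMk, Linear.comp_smul, Preadditive.comp_sum,
        Finset.sum_congr rfl (fun a _ ↦ ?_), inv_card_smul_sum_const]
      rw [← act_naturality_assoc, sq'.fac_left_assoc, ← act_naturality, act_inv_act_assoc]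
    · apply (underlying G C).map_injective
      rw [Functor.map_comp, underlying_map_homMk, Linear.smul_comp, Preadditive.sum_comp,
        Finset.sum_congr rfl (fun a _ ↦ ?_), inv_card_smul_sum_const]
      rw [Category.assoc, Category.assoc, act_naturality, sq'.fac_right_assoc, ← act_naturality,
        act_inv_act_assoc]

section

variable [Finite G] [HasFiniteLimits C] (H : Subgroup G)

/-- Over `ℚ`, averaging is a map to the fixed points. -/
noncomputable def fixedPointsProj (X : GObj G C) :
    (underlying G C).obj X ⟶ (fixedPoints C H).obj X :=
  have := Fintype.ofFinite H
  fixedPointsLift H ((Nat.card H : ℚ)⁻¹ • ∑ h : H, act X (h : G)) (fun a ↦ by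
    rw [Linear.smul_comp, Preadditive.sum_comp]
    congr 1
    refine Fintype.sum_equiv (Equiv.mulLeft (a : H)) _ _ (fun g ↦ ?_)
    rw [← act_mul, Equiv.coe_mulLeft, Subgroup.coe_mul])

lemma fixedPointsProj_ι [h : Fintype H] (X : GObj G C) :
    fixedPointsProj H X ≫ fixedPointsι H X = (Nat.card H : ℚ)⁻¹ • ∑ h : H, act X (h : G) := by
  obtain rfl := Subsingleton.elim h (Fintype.ofFinite H)
  exact fixedPointsLift_ι _ _ _

lemma fixedPointsι_proj (X : GObj G C) :
    fixedPointsι H X ≫ fixedPointsProj H X = 𝟙 _ := by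
  have := Fintype.ofFinite H
  apply fixedPoints_hom_ext
  rw [Category.assoc, fixedPointsProj_ι, Linear.comp_smul, Preadditive.comp_sum,
    Finset.sum_congr rfl (fun h _ ↦ fixedPointsι_act H X h), inv_card_smul_sum_const,
    Category.id_comp]

lemma fixedPointsProj_naturality {X Y : GObj G C} (f : X ⟶ Y) :
    (underlying G C).map f ≫ fixedPointsProj H Y = fixedPointsProj H X ≫ (fixedPoints C H).map f := by
  have := Fintype.ofFinite H
  apply fixedPoints_hom_ext
  rw [Category.assoc, Category.assoc, fixedPointsι_naturality, reassoc_of% fixedPointsProj_ι H X,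
    fixedPointsProj_ι, Linear.comp_smul, Linear.smul_comp, Preadditive.comp_sum,
    Preadditive.sum_comp]
  congr 1
  exact Finset.sum_congr rfl (fun h _ ↦ (act_naturality f _).symm)

/-- The mean over the trivial group is the identity. With `fixedPointsι_proj`, this identifies the
underlying object with its fixed points under `⊥`. -/
lemma fixedPointsProj_ι_bot (X : GObj G C) :
    fixedPointsProj (⊥ : Subgroup G) X ≫ fixedPointsι ⊥ X = 𝟙 _ := by
  have := Fintype.ofFinite (⊥ : Subgroup G)
  rw [fixedPointsProj_ι, Finset.sum_congr rfl (fun h _ ↦ ?_), inv_card_smul_sum_const]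
  rw [Subsingleton.elim h 1, Subgroup.coe_one, act_one]

/-- Over `ℚ`, the map induced on fixed points is a retract of the underlying map. -/
noncomputable def fixedPointsRetract {X Y : GObj G C} (f : X ⟶ Y) :
    RetractArrow ((fixedPoints C H).map f) ((underlying G C).map f) where
  i := Arrow.homMk (fixedPointsι H X) (fixedPointsι H Y) (fixedPointsι_naturality H f).symm
  r := Arrow.homMk (fixedPointsProj H X) (fixedPointsProj H Y) (fixedPointsProj_naturality H f).symm
  retract := by
    ext
    · exact fixedPointsι_proj H X
    · exact fixedPointsι_proj H Y

/-- The underlying map is a retract of the map induced on fixed points of the trivial subgroup. -/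
noncomputable def retractFixedPointsBot {X Y : GObj G C} (f : X ⟶ Y) :
    RetractArrow ((underlying G C).map f) ((fixedPoints C (⊥ : Subgroup G)).map f) where
  i := Arrow.homMk (fixedPointsProj ⊥ X) (fixedPointsProj ⊥ Y) (fixedPointsProj_naturality ⊥ f).symm
  r := Arrow.homMk (fixedPointsι ⊥ X) (fixedPointsι ⊥ Y) (fixedPointsι_naturality ⊥ f).symm
  retract := by
    ext
    · exact fixedPointsProj_ι_bot X
    · exact fixedPointsProj_ι_bot Y

end

end Averaging

end GObj

/-! ### Model structures with functorial factorizations, and their passage to `G`-objects. -/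

namespace ModelClasses

open MorphismProperty

/-- The axioms of a model category on three classes of morphisms, apart from the existence of
finite limits and colimits, with functorial factorizations. -/
structure IsFunctorialModel {C : Type u'} [Category.{v'} C] (M : ModelClasses C) : Prop where
  two_out_of_three : M.weq.HasTwoOutOfThreeProperty
  weq_retracts : M.weq.IsStableUnderRetracts
  fib_retracts : M.fib.IsStableUnderRetracts
  cof_retracts : M.cof.IsStableUnderRetracts
  lift_weq_cof {A B X Y : C} (i : A ⟶ B) (p : X ⟶ Y) (hi : M.cof i) (hi' : M.weq i)
    (hp : M.fib p) : HasLiftingProperty i p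
  lift_weq_fib {A B X Y : C} (i : A ⟶ B) (p : X ⟶ Y) (hi : M.cof i) (hp : M.fib p)
    (hp' : M.weq p) : HasLiftingProperty i p
  factorization_weq_cof : HasFunctorialFactorization (M.cof ⊓ M.weq) M.fib
  factorization_weq_fib : HasFunctorialFactorization M.cof (M.fib ⊓ M.weq)

namespace IsFunctorialModel

variable {C : Type u'} [Category.{v'} C] {M : ModelClasses C}

/-- The underlying model category structure. -/
noncomputable abbrev modelCategory (h : M.IsFunctorialModel) [HasFiniteLimits C]
    [HasFiniteColimits C] : ModelCategory C :=
  letI : CategoryWithCofibrations C := ⟨M.cof⟩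
  letI : CategoryWithFibrations C := ⟨M.fib⟩
  letI : CategoryWithWeakEquivalences C := ⟨M.weq⟩
  have := h.factorization_weq_cof
  have := h.factorization_weq_fib
  { categoryWithFibrations := ⟨M.fib⟩
    categoryWithCofibrations := ⟨M.cof⟩
    categoryWithWeakEquivalences := ⟨M.weq⟩
    cm2 := h.two_out_of_three
    cm3a := h.weq_retracts
    cm3b := h.fib_retracts
    cm3c := h.cof_retracts
    cm4a i p hi hi' hp := h.lift_weq_cof i p ((cofibration_iff i).1 hi)
      ((weakEquivalence_iff i).1 hi') ((fibration_iff p).1 hp)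
    cm4b i p hi hp hp' := h.lift_weq_fib i p ((cofibration_iff i).1 hi)
      ((fibration_iff p).1 hp) ((weakEquivalence_iff p).1 hp')
    cm5a := (inferInstance : HasFactorization (M.cof ⊓ M.weq) M.fib)
    cm5b := (inferInstance : HasFactorization M.cof (M.fib ⊓ M.weq)) }

lemma isModelStructure (h : M.IsFunctorialModel) [HasFiniteLimits C] [HasFiniteColimits C] :
    M.IsModelStructure :=
  ⟨h.modelCategory, rfl, rfl, rfl⟩

/-- Retract argument: a map lifting against the acyclic fibrations is a retract of the cofibration
in its own factorization. -/
lemma cof_eq_llp (h : M.IsFunctorialModel) : (M.weq ⊓ M.fib).llp = M.cof := by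
  have := h.factorization_weq_fib
  have := h.cof_retracts
  rw [inf_comm]
  exact llp_eq_of_le_llp_of_hasFactorization_of_isStableUnderRetracts
    (fun _ _ _ hi _ _ _ hp ↦ h.lift_weq_fib _ _ hi hp.1 hp.2)

lemma fib_eq_rlp (h : M.IsFunctorialModel) : (M.weq ⊓ M.cof).rlp = M.fib := by
  have := h.factorization_weq_cof
  have := h.fib_retracts
  rw [inf_comm]
  exact rlp_eq_of_le_rlp_of_hasFactorization_of_isStableUnderRetracts
    (fun _ _ _ hp _ _ _ hi ↦ h.lift_weq_cof _ _ hi.1 hi.2 hp)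

variable (G : Type w) [Group G]

/-- `SingleObj G` has a single object, so underlying classes are objectwise classes of a functor
category, to which functorial factorizations extend. -/
lemma inverseImage_underlying_eq (W : MorphismProperty C) :
    W.inverseImage (GObj.underlying G C) = W.functorCategory (SingleObj G) := by
  ext X Y f
  exact ⟨fun h _ ↦ h, fun h ↦ h _⟩

/-- For a model structure on a `ℚ`-linear category, the underlying weak equivalences, cofibrations
and fibrations of `G`-objects form a model structure. -/
lemma gObj [Finite G] [Preadditive C] [Linear ℚ C] (h : M.IsFunctorialModel) :
    (⟨M.naiveWeq G, M.underlyingCof G, M.naiveFib G⟩ :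
      ModelClasses (GObj G C)).IsFunctorialModel where
  two_out_of_three := by
    have := h.two_out_of_three
    exact inferInstanceAs (M.weq.inverseImage (GObj.underlying G C)).HasTwoOutOfThreeProperty
  weq_retracts := by
    have := h.weq_retracts
    exact inferInstanceAs (M.weq.inverseImage (GObj.underlying G C)).IsStableUnderRetracts
  fib_retracts := by
    have := h.fib_retracts
    exact inferInstanceAs (M.fib.inverseImage (GObj.underlying G C)).IsStableUnderRetracts
  cof_retracts := by
    have := h.cof_retracts
    exact inferInstanceAs (M.cof.inverseImage (GObj.underlying G C)).IsStableUnderRetracts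
  lift_weq_cof i p hi hi' hp := by
    have := h.lift_weq_cof _ _ hi hi' hp
    exact GObj.hasLiftingProperty_of_underlying i p
  lift_weq_fib i p hi hp hp' := by
    have := h.lift_weq_fib _ _ hi hp hp'
    exact GObj.hasLiftingProperty_of_underlying i p
  factorization_weq_cof := by
    have := h.factorization_weq_cof
    change HasFunctorialFactorization ((M.cof ⊓ M.weq).inverseImage (GObj.underlying G C))
      (M.fib.inverseImage (GObj.underlying G C))
    rw [inverseImage_underlying_eq, inverseImage_underlying_eq]
    infer_instance
  factorization_weq_fib := by
    have := h.factorization_weq_fib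
    change HasFunctorialFactorization (M.cof.inverseImage (GObj.underlying G C))
      ((M.fib ⊓ M.weq).inverseImage (GObj.underlying G C))
    rw [inverseImage_underlying_eq, inverseImage_underlying_eq]
    infer_instance

variable [Finite G] [Preadditive C] [Linear ℚ C]

/-- The model structure `gObj` has underlying cofibrations but naive weak equivalences and
fibrations, and the latter two determine the cofibrations by lifting. -/
lemma naiveCof_eq (h : M.IsFunctorialModel) : M.naiveCof G = M.underlyingCof G :=
  (h.gObj G).cof_eq_llp

lemma injective_eq_naive (h : M.IsFunctorialModel) : M.injective G = M.naive G :=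
  ModelClasses.ext rfl (h.naiveCof_eq G).symm (h.gObj G).fib_eq_rlp

lemma naive_isModelStructure [HasFiniteLimits C] [HasFiniteColimits C]
    (h : M.IsFunctorialModel) : (M.naive G).IsModelStructure := by
  have := (h.gObj G).isModelStructure
  rwa [← h.naiveCof_eq G] at this

variable [HasFiniteLimits C]

/-- Every `f^H` is a retract of the underlying map, which is in turn a retract of `f^H` for `H`
trivial. -/
lemma forall_fixedPoints_iff (W : MorphismProperty C) [W.IsStableUnderRetracts] {X Y : GObj G C}
    (f : X ⟶ Y) :
    (∀ H : Subgroup G, W ((GObj.fixedPoints C H).map f)) ↔ W ((GObj.underlying G C).map f) :=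
  ⟨fun h ↦ of_retract (GObj.retractFixedPointsBot f) (h ⊥),
    fun h H ↦ of_retract (GObj.fixedPointsRetract H f) h⟩

lemma genuineCof_eq (h : M.IsFunctorialModel) : M.genuineCof G = M.naiveCof G := by
  have := h.weq_retracts
  have := h.fib_retracts
  have h₁ : M.genuineWeq G = M.naiveWeq G := by
    ext X Y f
    exact forall_fixedPoints_iff G M.weq f
  have h₂ : M.genuineFib G = M.naiveFib G := by
    ext X Y f
    exact forall_fixedPoints_iff G M.fib f
  rw [genuineCof, naiveCof, h₁, h₂]

lemma blended_eq_injective (h : M.IsFunctorialModel) : M.blended G = M.injective G := by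
  have : M.genuineCof G = M.underlyingCof G := (h.genuineCof_eq G).trans (h.naiveCof_eq G)
  rw [blended, blendedFib, this]
  rfl

end IsFunctorialModel

end ModelClasses

/-! ### Cones on graded objects -/

namespace ChainComplex

section GradedCone

variable {A : Type u'} [Category.{v'} A] [Preadditive A]

/-- A contraction of a chain complex gives a homotopy from the identity to zero. -/
noncomputable def homotopyOfContraction {K : ChainComplex A ℕ} (h : ∀ n, K.X n ⟶ K.X (n + 1))
    (h₀ : h 0 ≫ K.d 1 0 = 𝟙 _)
    (hs : ∀ n, K.d (n + 1) n ≫ h n + h (n + 1) ≫ K.d (n + 2) (n + 1) = 𝟙 _) :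
    Homotopy (𝟙 K) 0 :=
  let k : ∀ i j, (ComplexShape.down ℕ).Rel j i → (K.X i ⟶ K.X j) :=
    fun i j hij ↦ h i ≫ eqToHom (by rw [show i + 1 = j from hij])
  (Homotopy.ofEq (by
    ext n
    obtain _ | n := n
    · rw [Homotopy.nullHomotopicMap'_f_of_not_rel_left (k₁ := 1) (k₀ := 0) (by simp) (by simp)]
      simpa [k] using h₀.symm
    · rw [Homotopy.nullHomotopicMap'_f (k₂ := n + 2) (k₁ := n + 1) (k₀ := n) (by simp) (by simp)]
      simpa [k] using (hs n).symm)).trans (Homotopy.nullHomotopy' k)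

variable [HasBinaryBiproducts A]

/-- The objects of the cone on a graded object. -/
noncomputable def gradedConeX (V : ℕ → A) : ℕ → A
  | 0 => V 0
  | n + 1 => V (n + 1) ⊞ V n

/-- The projection of the cone to the graded object. -/
noncomputable def gradedConeXπ (V : ℕ → A) : ∀ n, gradedConeX V n ⟶ V n
  | 0 => 𝟙 (V 0)
  | n + 1 => (biprod.fst : V (n + 1) ⊞ V n ⟶ V (n + 1))

/-- The inclusion of the graded object in the cone. -/
noncomputable def gradedConeXι (V : ℕ → A) : ∀ n, V n ⟶ gradedConeX V n
  | 0 => 𝟙 (V 0)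
  | n + 1 => (biprod.inl : V (n + 1) ⟶ V (n + 1) ⊞ V n)

lemma gradedConeXι_π (V : ℕ → A) : ∀ n, gradedConeXι V n ≫ gradedConeXπ V n = 𝟙 _
  | 0 => Category.comp_id _
  | _ + 1 => biprod.inl_fst

/-- The projection of the cone to the shifted graded object. -/
noncomputable def gradedConeXπ' (V : ℕ → A) (n : ℕ) : gradedConeX V (n + 1) ⟶ V n :=
  (biprod.snd : V (n + 1) ⊞ V n ⟶ V n)

/-- The inclusion of the shifted graded object in the cone. -/
noncomputable def gradedConeXι' (V : ℕ → A) (n : ℕ) : V n ⟶ gradedConeX V (n + 1) :=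
  (biprod.inr : V n ⟶ V (n + 1) ⊞ V n)

lemma gradedConeXι'_π (V : ℕ → A) (n : ℕ) : gradedConeXι' V n ≫ gradedConeXπ V (n + 1) = 0 :=
  biprod.inr_fst

lemma gradedConeXι_π' (V : ℕ → A) (n : ℕ) : gradedConeXι V (n + 1) ≫ gradedConeXπ' V n = 0 :=
  biprod.inl_snd

lemma gradedConeXι'_π' (V : ℕ → A) (n : ℕ) : gradedConeXι' V n ≫ gradedConeXπ' V n = 𝟙 _ :=
  biprod.inr_snd

lemma gradedConeX_total (V : ℕ → A) (n : ℕ) :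
    gradedConeXπ V (n + 1) ≫ gradedConeXι V (n + 1) + gradedConeXπ' V n ≫ gradedConeXι' V n =
      𝟙 _ :=
  biprod.total

/-- The cone on a graded object: the contractible complex which is `V (n + 1) ⊞ V n` in
degree `n + 1`, and `V 0` in degree `0`. -/
noncomputable def gradedCone (V : ℕ → A) : ChainComplex A ℕ :=
  ChainComplex.of (gradedConeX V) (fun n ↦ gradedConeXπ' V n ≫ gradedConeXι V n)
    (fun n ↦ by simp [reassoc_of% gradedConeXι_π'])

variable (V : ℕ → A) {K L : ChainComplex A ℕ}

/-- The projection of the cone to the graded object. -/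
noncomputable def gradedConeπ (n : ℕ) : (gradedCone V).X n ⟶ V n := gradedConeXπ V n

/-- The inclusion of the shifted graded object in the cone. -/
noncomputable def gradedConeι (n : ℕ) : V n ⟶ (gradedCone V).X (n + 1) := gradedConeXι' V n

lemma gradedConeι_comp_d (n : ℕ) :
    gradedConeι V n ≫ (gradedCone V).d (n + 1) n = gradedConeXι V n :=
  (gradedConeXι' V n ≫= ChainComplex.of_d (gradedConeX V) (fun n ↦ gradedConeXπ' V n ≫ gradedConeXι V n) n).trans
    (by rw [reassoc_of% gradedConeXι'_π' V n])

@[simp]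
lemma gradedConeι_d_π (n : ℕ) :
    gradedConeι V n ≫ (gradedCone V).d (n + 1) n ≫ gradedConeπ V n = 𝟙 _ := by
  rw [← Category.assoc, gradedConeι_comp_d]
  exact gradedConeXι_π V n

@[simp]
lemma gradedConeι_d_π_assoc (n : ℕ) {Z : A} (k : V n ⟶ Z) :
    gradedConeι V n ≫ (gradedCone V).d (n + 1) n ≫ gradedConeπ V n ≫ k = k := by
  rw [reassoc_of% gradedConeι_d_π V n]

@[simp]
lemma gradedConeι_π (n : ℕ) : gradedConeι V n ≫ gradedConeπ V (n + 1) = 0 :=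
  gradedConeXι'_π V n

@[simp]
lemma gradedConeι_π_assoc (n : ℕ) {Z : A} (k : V (n + 1) ⟶ Z) :
    gradedConeι V n ≫ gradedConeπ V (n + 1) ≫ k = 0 := by
  rw [reassoc_of% gradedConeι_π V n, zero_comp]

@[simp]
lemma gradedCone_total_zero :
    gradedConeπ V 0 ≫ gradedConeι V 0 ≫ (gradedCone V).d 1 0 = 𝟙 _ := by
  rw [gradedConeι_comp_d]
  exact Category.comp_id _

lemma gradedCone_total (n : ℕ) :
    gradedConeπ V (n + 1) ≫ gradedConeι V (n + 1) ≫ (gradedCone V).d (n + 2) (n + 1) +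
      (gradedCone V).d (n + 1) n ≫ gradedConeπ V n ≫ gradedConeι V n = 𝟙 _ := by
  have h : (gradedCone V).d (n + 1) n ≫ gradedConeπ V n = gradedConeXπ' V n := by
    refine ((ChainComplex.of_d (gradedConeX V) (fun n ↦ gradedConeXπ' V n ≫ gradedConeXι V n) n) =≫ gradedConeXπ V n).trans ?_
    simp [gradedConeXι_π]
  rw [gradedConeι_comp_d, reassoc_of% h]
  exact gradedConeX_total V n

variable {V}

/-- Half of a universal property: with `toGradedCone`, chain maps into the cone are arbitrary
families `K.X n ⟶ V n`, so the cone is right adjoint to forgetting the differential. -/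
lemma to_gradedCone_ext {f g : K ⟶ gradedCone V}
    (h : ∀ n, f.f n ≫ gradedConeπ V n = g.f n ≫ gradedConeπ V n) : f = g := by
  ext n
  obtain _ | n := n
  · rw [← Category.comp_id (f.f 0), ← Category.comp_id (g.f 0), ← gradedCone_total_zero,
      reassoc_of% (h 0)]
  · rw [← Category.comp_id (f.f _), ← Category.comp_id (g.f _), ← gradedCone_total,
      Preadditive.comp_add, Preadditive.comp_add, reassoc_of% (h (n + 1)), f.comm_assoc,
      g.comm_assoc, reassoc_of% (h n)]

lemma from_gradedCone_ext {f g : gradedCone V ⟶ K}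
    (h : ∀ n, gradedConeι V n ≫ f.f (n + 1) = gradedConeι V n ≫ g.f (n + 1)) : f = g := by
  ext n
  obtain _ | n := n
  · rw [← Category.id_comp (f.f 0), ← Category.id_comp (g.f 0), ← gradedCone_total_zero]
    simp only [Category.assoc, ← f.comm, ← g.comm]
    rw [reassoc_of% (h 0)]
  · rw [← Category.id_comp (f.f _), ← Category.id_comp (g.f _), ← gradedCone_total]
    simp only [Preadditive.add_comp, Category.assoc, ← f.comm, ← g.comm]
    rw [h n, reassoc_of% (h (n + 1))]

/-- The morphism to a cone given by a morphism of graded objects. -/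
noncomputable def toGradedCone (φ : ∀ n, K.X n ⟶ V n) : K ⟶ gradedCone V :=
  ofHom (fun
    | 0 => φ 0 ≫ gradedConeι V 0 ≫ (gradedCone V).d 1 0
    | n + 1 => φ (n + 1) ≫ gradedConeι V (n + 1) ≫ (gradedCone V).d (n + 2) (n + 1) +
        K.d (n + 1) n ≫ φ n ≫ gradedConeι V n) (by rintro (_ | n) <;> simp <;> rfl)

@[simp]
lemma toGradedCone_π (φ : ∀ n, K.X n ⟶ V n) (n : ℕ) :
    (toGradedCone φ).f n ≫ gradedConeπ V n = φ n := by
  obtain _ | n := n <;> simp [toGradedCone]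

@[simp]
lemma toGradedCone_π_assoc (φ : ∀ n, K.X n ⟶ V n) (n : ℕ) {Z : A} (k : V n ⟶ Z) :
    (toGradedCone φ).f n ≫ gradedConeπ V n ≫ k = φ n ≫ k := by
  rw [← Category.assoc, toGradedCone_π]

/-- The morphism from a cone given by a morphism of graded objects. -/
noncomputable def fromGradedCone (ψ : ∀ n, V n ⟶ K.X (n + 1)) : gradedCone V ⟶ K :=
  ofHom (fun
    | 0 => gradedConeπ V 0 ≫ ψ 0 ≫ K.d 1 0
    | n + 1 => gradedConeπ V (n + 1) ≫ ψ (n + 1) ≫ K.d (n + 2) (n + 1) +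
        (gradedCone V).d (n + 1) n ≫ gradedConeπ V n ≫ ψ n) (by rintro (_ | n) <;> simp <;> rfl)

@[simp]
lemma ι_fromGradedCone (ψ : ∀ n, V n ⟶ K.X (n + 1)) (n : ℕ) :
    gradedConeι V n ≫ (fromGradedCone ψ).f (n + 1) = ψ n := by
  simp [fromGradedCone]

@[simp]
lemma ι_fromGradedCone_assoc (ψ : ∀ n, V n ⟶ K.X (n + 1)) (n : ℕ) {Z : A}
    (k : K.X (n + 1) ⟶ Z) :
    gradedConeι V n ≫ (fromGradedCone ψ).f (n + 1) ≫ k = ψ n ≫ k := by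
  rw [← Category.assoc, ι_fromGradedCone]

/-- The cone on a graded object is contractible. -/
noncomputable def gradedConeHomotopy (V : ℕ → A) : Homotopy (𝟙 (gradedCone V)) 0 :=
  homotopyOfContraction (fun n ↦ gradedConeπ V n ≫ gradedConeι V n)
    (by simp) (fun n ↦ by
      rw [Category.assoc, add_comm (_ ≫ _)]
      exact gradedCone_total V n)

/-- A complex with a contraction is a retract of the cone on its underlying graded object. -/
noncomputable def retractGradedCone (h : ∀ n, K.X n ⟶ K.X (n + 1))
    (h₀ : h 0 ≫ K.d 1 0 = 𝟙 _)
    (hs : ∀ n, K.d (n + 1) n ≫ h n + h (n + 1) ≫ K.d (n + 2) (n + 1) = 𝟙 _) :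
    Retract K (gradedCone K.X) where
  i := toGradedCone (fun _ ↦ 𝟙 _)
  r := fromGradedCone h
  retract := by
    ext n
    obtain _ | n := n
    · simp [toGradedCone, fromGradedCone, h₀]
    · simpa [toGradedCone, fromGradedCone, add_comm] using hs n

variable (A) in
/-- The cone on the underlying graded object of a chain complex, as a functor. -/
noncomputable def coneFunctor : ChainComplex A ℕ ⥤ ChainComplex A ℕ where
  obj K := gradedCone K.X
  map f := toGradedCone (fun n ↦ gradedConeπ _ n ≫ f.f n)
  map_id K := to_gradedCone_ext (fun n ↦ by simp)
  map_comp f g := to_gradedCone_ext (fun n ↦ by simp)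

variable (A) in
/-- The natural inclusion of a complex in its cone. -/
noncomputable def toConeFunctor : 𝟭 (ChainComplex A ℕ) ⟶ coneFunctor A where
  app K := toGradedCone (fun n ↦ 𝟙 _)
  naturality K L f := to_gradedCone_ext (fun n ↦ by simp [coneFunctor])

variable (A) in
/-- The cone on the shift of the underlying graded object of a chain complex, as a functor. -/
noncomputable def pathFunctor : ChainComplex A ℕ ⥤ ChainComplex A ℕ where
  obj K := gradedCone (fun n ↦ K.X (n + 1))
  map f := toGradedCone (fun n ↦ gradedConeπ _ n ≫ f.f (n + 1))
  map_id K := to_gradedCone_ext (fun n ↦ by simp)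
  map_comp f g := to_gradedCone_ext (fun n ↦ by simp)

lemma gradedConeι_toGradedCone {W : ℕ → A} (φ : ∀ n, V n ⟶ W n) (n : ℕ) :
    gradedConeι V n ≫ (toGradedCone (fun n ↦ gradedConeπ V n ≫ φ n)).f (n + 1) =
      φ n ≫ gradedConeι W n := by
  simp [toGradedCone]

variable (A) in
/-- The natural morphism from the cone of the shift of a complex. -/
noncomputable def fromPathFunctor : pathFunctor A ⟶ 𝟭 (ChainComplex A ℕ) where
  app K := fromGradedCone (fun n ↦ 𝟙 _)
  naturality K L f := from_gradedCone_ext (fun n ↦ by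
    simp [pathFunctor, reassoc_of% gradedConeι_toGradedCone])

end GradedCone

end ChainComplex

/-! ### Quasi-isomorphisms tested on elements, so that non-additive maps can be used later. -/

namespace ModuleCatComplex
variable {R : Type v'} [Ring R] {ι : Type*} {c : ComplexShape ι}

lemma exists_cycles_of_d_eq_zero (K : HomologicalComplex (ModuleCat.{u} R) c) {n : ι} (x : K.X n)
    (hx : ∀ m, K.d n m x = 0) : ∃ z : K.cycles n, K.iCycles n z = x :=
  ⟨K.cyclesMk x (c.next n) rfl (hx _), K.i_cyclesMk x (c.next n) rfl (hx _)⟩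

lemma d_iCycles (K : HomologicalComplex (ModuleCat.{u} R) c) {n : ι} (z : K.cycles n) (m : ι) :
    K.d n m (K.iCycles n z) = 0 := by
  rw [← ConcreteCategory.comp_apply, K.iCycles_d]
  rfl

lemma iCycles_injective (K : HomologicalComplex (ModuleCat.{u} R) c) (n : ι) :
    Function.Injective (K.iCycles n) :=
  (ModuleCat.mono_iff_injective _).1 inferInstance

lemma homologyπ_surjective (K : HomologicalComplex (ModuleCat.{u} R) c) (n : ι) :
    Function.Surjective (K.homologyπ n) :=
  (ModuleCat.epi_iff_surjective _).1 inferInstance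

lemma homologyπ_eq_zero_iff (K : HomologicalComplex (ModuleCat.{u} R) c) {n : ι} (z : K.cycles n) :
    K.homologyπ n z = 0 ↔ ∃ m, ∃ w : K.X m, K.iCycles n z = K.d m n w := by
  constructor
  · intro h
    have := ShortComplex.exact_of_g_is_cokernel
      (ShortComplex.mk _ _ (K.toCycles_comp_homologyπ (c.prev n) n))
      (K.homologyIsCokernel (c.prev n) n rfl)
    rw [ShortComplex.moduleCat_exact_iff] at this
    obtain ⟨w, hw⟩ := this z h
    refine ⟨_, w, ?_⟩
    rw [← K.toCycles_i, ConcreteCategory.comp_apply]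
    exact congr_arg _ hw.symm
  · rintro ⟨m, w, hw⟩
    rw [← K.toCycles_i, ConcreteCategory.comp_apply] at hw
    rw [iCycles_injective K n hw, ← ConcreteCategory.comp_apply, K.toCycles_comp_homologyπ]
    rfl

/-- A morphism of complexes of modules is a quasi-isomorphism iff it induces bijections on
classes of cycles modulo boundaries. -/
lemma quasiIso_iff_forall {K L : HomologicalComplex (ModuleCat.{u} R) c} (f : K ⟶ L) :
    QuasiIso f ↔ ∀ n,
      (∀ x : K.X n, (∀ m, K.d n m x = 0) → (∃ m, ∃ w : L.X m, f.f n x = L.d m n w) →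
        ∃ m, ∃ w : K.X m, x = K.d m n w) ∧
      (∀ y : L.X n, (∀ m, L.d n m y = 0) → ∃ x : K.X n, (∀ m, K.d n m x = 0) ∧
        ∃ m, ∃ w : L.X m, y = f.f n x + L.d m n w) := by
  rw [quasiIso_iff]
  refine forall_congr' (fun n ↦ ?_)
  have hi (z : K.cycles n) :
      L.iCycles n (HomologicalComplex.cyclesMap f n z) = f.f n (K.iCycles n z) := by
    rw [← ConcreteCategory.comp_apply, HomologicalComplex.cyclesMap_i,
      ConcreteCategory.comp_apply]
  have hπ (z : K.cycles n) : HomologicalComplex.homologyMap f n (K.homologyπ n z) =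
      L.homologyπ n (HomologicalComplex.cyclesMap f n z) := by
    rw [← ConcreteCategory.comp_apply, HomologicalComplex.homologyπ_naturality,
      ConcreteCategory.comp_apply]
  rw [quasiIsoAt_iff_isIso_homologyMap, ConcreteCategory.isIso_iff_bijective]
  refine and_congr ?_ ?_
  · rw [injective_iff_map_eq_zero]
    constructor
    · rintro h x hx hx'
      obtain ⟨z, rfl⟩ := exists_cycles_of_d_eq_zero K x hx
      rw [← homologyπ_eq_zero_iff]
      apply h
      rw [hπ, homologyπ_eq_zero_iff, hi]
      exact hx'
    · intro h a ha
      obtain ⟨z, rfl⟩ := homologyπ_surjective K n a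
      rw [hπ, homologyπ_eq_zero_iff, hi] at ha
      rw [homologyπ_eq_zero_iff]
      exact h _ (d_iCycles K z) ha
  · constructor
    · intro h y hy
      obtain ⟨z, rfl⟩ := exists_cycles_of_d_eq_zero L y hy
      obtain ⟨a, ha⟩ := h (L.homologyπ n z)
      obtain ⟨z', rfl⟩ := homologyπ_surjective K n a
      have : L.homologyπ n (z - HomologicalComplex.cyclesMap f n z') = 0 := by
        rw [map_sub, ← hπ, ha, sub_self]
      obtain ⟨m, w, hw⟩ := (homologyπ_eq_zero_iff L _).1 this
      refine ⟨K.iCycles n z', d_iCycles K z', m, w, ?_⟩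
      rw [← hw, map_sub, hi]
      abel
    · intro h b
      obtain ⟨z, rfl⟩ := homologyπ_surjective L n b
      obtain ⟨x, hx, m, w, hw⟩ := h _ (d_iCycles L z)
      obtain ⟨z', rfl⟩ := exists_cycles_of_d_eq_zero K x hx
      refine ⟨K.homologyπ n z', ?_⟩
      rw [hπ, ← sub_eq_zero, ← map_sub, homologyπ_eq_zero_iff]
      refine ⟨m, -w, ?_⟩
      rw [map_sub, map_neg, hw, hi]
      abel

end ModuleCatComplex

/-! ### Functorial factorizations through a biproduct. -/

section

variable {C : Type u'} [Category.{v'} C] [Preadditive C] [HasBinaryBiproducts C]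
  {W₁ W₂ : MorphismProperty C}

/-- The functorial factorization `X ⟶ X ⊞ F Y ⟶ Y` given by a natural morphism `F Y ⟶ Y`. -/
noncomputable def biprodDescFactorization (F : C ⥤ C) (ε : ∀ X, F.obj X ⟶ X)
    (hε : ∀ {X Y : C} (f : X ⟶ Y), F.map f ≫ ε Y = ε X ≫ f)
    (h₁ : ∀ X Y : C, W₁ (biprod.inl : X ⟶ X ⊞ F.obj Y))
    (h₂ : ∀ {X Y : C} (f : X ⟶ Y), W₂ (biprod.desc f (ε Y))) :
    MorphismProperty.FunctorialFactorizationData W₁ W₂ where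
  Z :=
    { obj f := f.left ⊞ F.obj f.right
      map φ := biprod.map φ.left (F.map φ.right)
      map_id f := biprod.hom_ext' _ _ (by simp) (by simp)
      map_comp φ ψ := biprod.hom_ext' _ _ (by simp) (by simp) }
  i :=
    { app f := biprod.inl
      naturality f g φ := (biprod.inl_map φ.left (F.map φ.right)).symm }
  p :=
    { app f := biprod.desc f.hom (ε f.right)
      naturality f g φ := by
        change biprod.map φ.left (F.map φ.right) ≫ biprod.desc g.hom (ε g.right) =
          biprod.desc f.hom (ε f.right) ≫ φ.right
        ext <;> simp [hε] }
  fac := by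
    ext f
    exact biprod.inl_desc _ _
  hi f := h₁ _ _
  hp f := h₂ _

/-- The functorial factorization `X ⟶ Y ⊞ F X ⟶ Y` given by a natural morphism `X ⟶ F X`. -/
noncomputable def biprodLiftFactorization (F : C ⥤ C) (η : ∀ X, X ⟶ F.obj X)
    (hη : ∀ {X Y : C} (f : X ⟶ Y), f ≫ η Y = η X ≫ F.map f)
    (h₁ : ∀ {X Y : C} (f : X ⟶ Y), W₁ (biprod.lift f (η X)))
    (h₂ : ∀ X Y : C, W₂ (biprod.fst : Y ⊞ F.obj X ⟶ Y)) :
    MorphismProperty.FunctorialFactorizationData W₁ W₂ where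
  Z :=
    { obj f := f.right ⊞ F.obj f.left
      map φ := biprod.map φ.right (F.map φ.left)
      map_id f := biprod.hom_ext' _ _ (by simp) (by simp)
      map_comp φ ψ := biprod.hom_ext' _ _ (by simp) (by simp) }
  i :=
    { app f := biprod.lift f.hom (η f.left)
      naturality f g φ := by
        change φ.left ≫ biprod.lift g.hom (η g.left) =
          biprod.lift f.hom (η f.left) ≫ biprod.map φ.right (F.map φ.left)
        ext <;> simp [hη] }
  p :=
    { app f := biprod.fst
      naturality f g φ := biprod.map_fst φ.right (F.map φ.left) }
  fac := by
    ext f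
    exact biprod.lift_fst _ _
  hi f := h₁ _
  hp f := h₂ _ _

end

/-! ### The projective model structure on rational chain complexes. -/

namespace ChQ

open ChainComplex

/-- Vector spaces split: `g` extends to all of `W` a section of the corestriction of `f` to its
range. -/
lemma exists_pseudo_inverse {V W : ModuleCat.{u} ℚ} (f : V ⟶ W) : ∃ g : W ⟶ V, f ≫ g ≫ f = f := by
  obtain ⟨s, hs⟩ := LinearMap.exists_rightInverse_of_surjective f.hom.rangeRestrict
    (LinearMap.range_rangeRestrict _)
  obtain ⟨g, hg⟩ := LinearMap.exists_extend s
  refine ⟨ModuleCat.ofHom g, ?_⟩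
  ext x
  have h₁ := LinearMap.congr_fun hg (f.hom.rangeRestrict x)
  have h₂ := congr_arg Subtype.val (LinearMap.congr_fun hs (f.hom.rangeRestrict x))
  dsimp at h₁ h₂ ⊢
  exact (congr_arg f h₁).trans h₂

lemma exists_extension {X Y V : ModuleCat.{u} ℚ} (f : X ⟶ Y) [Mono f] (g : X ⟶ V) :
    ∃ φ : Y ⟶ V, f ≫ φ = g := by
  obtain ⟨r, hr⟩ := LinearMap.exists_leftInverse_of_injective f.hom
    (LinearMap.ker_eq_bot.2 ((ModuleCat.mono_iff_injective f).1 inferInstance))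
  exact ⟨ModuleCat.ofHom r ≫ g, by ext x; exact congr_arg g (LinearMap.congr_fun hr x)⟩

lemma exists_lift {X Y V : ModuleCat.{u} ℚ} (f : X ⟶ Y) (hf : Function.Surjective f) (g : V ⟶ Y) :
    ∃ φ : V ⟶ X, φ ≫ f = g := by
  have := Module.Free.of_divisionRing ℚ Y
  have : Module.Projective ℚ Y := .of_free
  obtain ⟨r, hr⟩ := LinearMap.exists_rightInverse_of_surjective f.hom (LinearMap.range_eq_top.2 hf)
  exact ⟨g ≫ ModuleCat.ofHom r, by ext x; exact LinearMap.congr_fun hr (g x)⟩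

/-- Maps into the cone are families of degreewise maps, and each of these extends along an injection
of rational vector spaces. -/
lemma injective_gradedCone (V : ℕ → ModuleCat.{u} ℚ) : Injective (gradedCone V) where
  factors {X Y} g f _ := by
    choose φ hφ using fun n ↦ exists_extension (f.f n) (g.f n ≫ gradedConeπ V n)
    exact ⟨toGradedCone φ, to_gradedCone_ext (fun n ↦ by simp [hφ])⟩

lemma exists_d_eq_of_acyclic {K : ChQ.{u}} (hK : K.Acyclic) {n : ℕ} (x : K.X n)
    (hx : ∀ m, K.d n m x = 0) : ∃ w, K.d (n + 1) n w = x := by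
  have := hK n
  rw [K.exactAt_iff' (n + 1) n _ (by simp) rfl, ShortComplex.moduleCat_exact_iff] at this
  exact this x (hx _)

/-- Acyclic complexes of rational vector spaces are injective objects. -/
lemma injective_of_acyclic {K : ChQ.{u}} (hK : K.Acyclic) : Injective K := by
  choose σ hσ using fun n ↦ exists_pseudo_inverse (K.d (n + 1) n)
  have hσ' {n : ℕ} (x : K.X n) (hx : ∀ m, K.d n m x = 0) : K.d (n + 1) n (σ n x) = x := by
    obtain ⟨w, rfl⟩ := exists_d_eq_of_acyclic hK x hx
    exact ConcreteCategory.congr_hom (hσ n) w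
  -- The `σ n` alone need not be a contraction. Applying first the projection `𝟙 - d ≫ σ` onto
  -- cycles gives one: on cycles `σ` inverts `d` by acyclicity, and `d ≫ d = 0` keeps `d ≫ h = d ≫
  -- σ`.
  let h : ∀ n, K.X n ⟶ K.X (n + 1)
    | 0 => σ 0
    | n + 1 => (𝟙 _ - K.d (n + 1) n ≫ σ n) ≫ σ (n + 1)
  have h₀ : h 0 ≫ K.d 1 0 = 𝟙 _ := by
    ext x
    exact hσ' x (fun m ↦ by rw [K.shape 0 m (by simp)]; rfl)
  have hd (n : ℕ) : K.d (n + 1) n ≫ h n = K.d (n + 1) n ≫ σ n := by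
    obtain _ | n := n <;> simp [h]
  have hs (n : ℕ) : K.d (n + 1) n ≫ h n + h (n + 1) ≫ K.d (n + 2) (n + 1) = 𝟙 _ := by
    rw [hd]
    suffices (𝟙 _ - K.d (n + 1) n ≫ σ n) ≫ σ (n + 1) ≫ K.d (n + 2) (n + 1) =
      𝟙 _ - K.d (n + 1) n ≫ σ n by simp only [h, Category.assoc, this, add_sub_cancel]
    ext x
    refine hσ' _ (fun m ↦ ?_)
    by_cases hm : m = n
    · subst hm
      refine (ConcreteCategory.congr_hom (?_ : (𝟙 _ - K.d (m + 1) m ≫ σ m) ≫ K.d (m + 1) m = 0) x)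
      simp [hσ]
    · rw [K.shape _ _ (by simpa using hm)]
      rfl
  have := injective_gradedCone K.X
  exact (retractGradedCone h h₀ hs).injective

/-- Only degree `0` needs an argument: surjectivity on `H₀` gives `y` up to a boundary `d w`, and
`w`, being of positive degree, lifts. -/
lemma surjective_of_quasiIso {X Y : ChQ.{u}} (p : X ⟶ Y) (hp : ChQ.posSurj p) [hp' : QuasiIso p]
    (n : ℕ) : Function.Surjective (p.f n) := by
  obtain _ | n := n
  · intro y
    obtain ⟨x, -, m, w, rfl⟩ := ((ModuleCatComplex.quasiIso_iff_forall p).1 hp' 0).2 y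
      (fun m ↦ by rw [Y.shape 0 m (by simp)]; rfl)
    obtain _ | m := m
    · exact ⟨x, by rw [Y.shape 0 0 (by simp)]; exact (add_zero _).symm⟩
    · obtain ⟨w, rfl⟩ := hp (m + 1) (by simp) w
      refine ⟨x + X.d (m + 1) 0 w, ?_⟩
      rw [map_add, ← ConcreteCategory.comp_apply, ← ConcreteCategory.comp_apply, p.comm]
  · exact hp _ (by simp)

/-- Monomorphisms have the left lifting property with respect to acyclic fibrations. -/
lemma hasLiftingProperty_of_mono {A B X Y : ChQ.{u}} (i : A ⟶ B) [Mono i] (p : X ⟶ Y)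
    (hp : ChQ.posSurj p) [QuasiIso p] : HasLiftingProperty i p := by
  have (n : ℕ) : Epi (p.f n) := (ModuleCat.epi_iff_surjective _).2 (surjective_of_quasiIso p hp n)
  have : Epi p := HomologicalComplex.epi_of_epi_f p inferInstance
  -- The kernel of `p` is acyclic by the long exact sequence, hence injective; and monomorphisms
  -- lift against epimorphisms with injective kernel.
  have hS : (ShortComplex.mk _ _ (kernel.condition p)).ShortExact :=
    { exact := ShortComplex.exact_kernel p }
  exact Abelian.epiWithInjectiveKernel.hasLiftingProperty
    ⟨inferInstance, injective_of_acyclic (hS.acyclic_X₁ (by assumption))⟩ i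

/-- The inclusion of a summand with complement a cone has the left lifting property with respect
to fibrations. -/
lemma llp_biprod_inl (X : ChQ.{u}) (V : ℕ → ModuleCat.{u} ℚ) :
    ChQ.posSurj.llp (biprod.inl : X ⟶ X ⊞ gradedCone V) := by
  intro E D p hp
  refine ⟨fun {t b} sq ↦ ?_⟩
  -- A lift on the cone summand amounts to a family of linear lifts along `p` in the degrees `n +
  -- 1`.
  choose ψ hψ using fun n ↦ exists_lift (p.f (n + 1)) (hp _ (by simp))
    (gradedConeι V n ≫ ((biprod.inr : _ ⟶ X ⊞ gradedCone V) ≫ b).f (n + 1))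
  refine ⟨⟨⟨biprod.desc t (fromGradedCone ψ), by simp, ?_⟩⟩⟩
  refine biprod.hom_ext' _ _ ?_ ?_
  · simp [sq.w]
  · simp only [biprod.inr_desc_assoc]
    exact from_gradedCone_ext (fun n ↦ by
      rw [HomologicalComplex.comp_f, ι_fromGradedCone_assoc, hψ])

/-- The inclusion of a summand with contractible complement is a homotopy equivalence. -/
noncomputable def biprodHomotopyEquiv (X : ChQ.{u}) (V : ℕ → ModuleCat.{u} ℚ) :
    HomotopyEquiv X (X ⊞ gradedCone V) where
  hom := biprod.inl
  inv := biprod.fst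
  homotopyHomInvId := Homotopy.ofEq (by simp)
  homotopyInvHomId := by
    refine (Homotopy.equivSubZero.2 ?_).symm
    refine (Homotopy.ofEq ?_).trans ((((gradedConeHomotopy V).compLeft biprod.snd).compRight
      (biprod.inr : _ ⟶ X ⊞ gradedCone V)).trans (Homotopy.ofEq (by simp)))
    simp [← biprod.total]

instance (X : ChQ.{u}) (V : ℕ → ModuleCat.{u} ℚ) :
    QuasiIso (biprod.inl : X ⟶ X ⊞ gradedCone V) :=
  (biprodHomotopyEquiv X V).quasiIso_hom

instance (X : ChQ.{u}) (V : ℕ → ModuleCat.{u} ℚ) :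
    QuasiIso (biprod.fst : X ⊞ gradedCone V ⟶ X) :=
  (biprodHomotopyEquiv X V).quasiIso_inv

/-- The functorial factorization into an acyclic cofibration followed by a fibration. -/
noncomputable def factorizationLLP :
    MorphismProperty.FunctorialFactorizationData
      (ChQ.posSurj.{u}.llp ⊓ HomologicalComplex.quasiIso _ _) ChQ.posSurj.{u} :=
  biprodDescFactorization (pathFunctor _)
    (fun X ↦ (fromGradedCone (fun n ↦ 𝟙 (X.X (n + 1))) : gradedCone (fun n ↦ X.X (n + 1)) ⟶ X))
    (fun f ↦ (fromPathFunctor (ModuleCat.{u} ℚ)).naturality f)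
    (fun X Y ↦ ⟨llp_biprod_inl X (fun n ↦ Y.X (n + 1)),
      inferInstanceAs (QuasiIso (biprod.inl : X ⟶ X ⊞ gradedCone (fun n ↦ Y.X (n + 1))))⟩)
    (fun {X Y} f n hn ↦ by
      obtain ⟨n, rfl⟩ := Nat.exists_eq_succ_of_ne_zero hn.ne'
      intro y
      refine ⟨(biprod.inr : _ ⟶ X ⊞ gradedCone (fun n ↦ Y.X (n + 1))).f (n + 1)
        (gradedConeι (fun n ↦ Y.X (n + 1)) n y), ?_⟩
      exact ConcreteCategory.congr_hom ((gradedConeι _ n ≫= (HomologicalComplex.congr_hom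
        (biprod.inr_desc f (fromGradedCone (fun n ↦ 𝟙 (Y.X (n + 1))))) (n + 1))).trans
          (ι_fromGradedCone _ _)) y)

/-- The functorial factorization into a monomorphism followed by an acyclic fibration. -/
noncomputable def factorizationMono :
    MorphismProperty.FunctorialFactorizationData (MorphismProperty.monomorphisms ChQ.{u})
      (ChQ.posSurj.{u} ⊓ HomologicalComplex.quasiIso _ _) :=
  biprodLiftFactorization (coneFunctor _)
    (fun X ↦ (toGradedCone (fun n ↦ 𝟙 (X.X n)) : X ⟶ gradedCone X.X))
    (fun f ↦ (toConeFunctor (ModuleCat.{u} ℚ)).naturality f)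
    (fun {X Y} f ↦ by
      have (n : ℕ) : Mono ((toGradedCone (fun n ↦ 𝟙 (X.X n))).f n) :=
        mono_of_mono_fac (toGradedCone_π (fun n ↦ 𝟙 (X.X n)) n)
      have : Mono (toGradedCone (fun n ↦ 𝟙 (X.X n))) := HomologicalComplex.mono_of_mono_f _ this
      exact mono_of_mono_fac (biprod.lift_snd f (toGradedCone (fun n ↦ 𝟙 (X.X n)))))
    (fun X Y ↦ ⟨fun n _ y ↦ ⟨(biprod.inl : Y ⟶ Y ⊞ gradedCone X.X).f n y, by
        exact ConcreteCategory.congr_hom (HomologicalComplex.congr_hom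
          (biprod.inl_fst (X := Y) (Y := gradedCone X.X)) n) y⟩,
      inferInstanceAs (QuasiIso (biprod.fst : Y ⊞ gradedCone X.X ⟶ Y))⟩)

end ChQ

open MorphismProperty in
lemma chQModel_isFunctorialModel : chQModel.{u}.IsFunctorialModel where
  two_out_of_three := inferInstanceAs (HomologicalComplex.quasiIso _ _).HasTwoOutOfThreeProperty
  weq_retracts := inferInstanceAs (HomologicalComplex.quasiIso _ _).IsStableUnderRetracts
  fib_retracts := ⟨fun r h n hn ↦ by
    rw [← ModuleCat.epi_iff_surjective]
    exact (MorphismProperty.epimorphisms _).of_retract (r.map (HomologicalComplex.eval _ _ n))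
      ((ModuleCat.epi_iff_surjective _).2 (h n hn))⟩
  cof_retracts := llp_isStableUnderRetracts _
  lift_weq_cof i p hi hi' hp := by
    -- Retract argument: by two-out-of-three `h.p` is an acyclic fibration, so the cofibration `i`
    -- lifts against it and is a retract of `h.i`, which lifts against all fibrations.
    let h := ChQ.factorizationLLP.factorizationData i
    have : QuasiIso i := hi'
    have : QuasiIso h.i := h.hi.2
    have : QuasiIso (h.i ≫ h.p) := by rwa [h.fac]
    have : QuasiIso h.p := quasiIso_of_comp_left h.i h.p
    have := hi h.p ⟨this, h.hp⟩
    exact of_retract (RetractArrow.ofLeftLiftingProperty h.fac) h.hi.1 p hp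
  lift_weq_fib i p hi hp hp' := hi p ⟨hp', hp⟩
  factorization_weq_cof := ⟨⟨ChQ.factorizationLLP.ofLE
    (fun _ _ _ h ↦ ⟨fun _ _ _ hp ↦ h.1 _ hp.2, h.2⟩) le_rfl⟩⟩
  factorization_weq_fib := ⟨⟨ChQ.factorizationMono.ofLE
    (fun _ _ i (_ : Mono i) _ _ p hp ↦ by
      have : QuasiIso p := hp.1
      exact ChQ.hasLiftingProperty_of_mono i p hp.2) le_rfl⟩⟩

/-! ### Sections of acyclic Kan fibrations are anodyne. -/

namespace SSet

open MonoidalCategory CartesianMonoidalCategory Simplicial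

variable {A B : SSet.{u}} (i : A ⟶ B) (r : B ⟶ A)

/-- The subcomplex of `B ⊗ Δ[1]` on which a deformation of `B` onto the image of `i` is
prescribed. -/
def deformationSubcomplex : (B ⊗ Δ[1] : SSet.{u}).Subcomplex where
  obj m := {x | x.1 ∈ Set.range (i.app m) ∨ ∃ c, ∀ k, stdSimplex.asOrderHom x.2 k = c}
  map φ := by
    rintro ⟨_, s⟩ (⟨a, rfl⟩ | ⟨c, hc⟩)
    · exact Or.inl ⟨A.map φ a, NatTrans.naturality_apply i φ a⟩
    · exact Or.inr ⟨c, fun k ↦ hc _⟩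

open Classical in
/-- The prescribed values of a deformation of `B` onto the image of `i`. -/
noncomputable def deformationValue {m : SimplexCategoryᵒᵖ} (b : B.obj m) (s : Δ[1].obj m) :
    B.obj m :=
  if stdSimplex.asOrderHom s 0 = 0 then b else i.app m (r.app m b)

/-- On the range of `i` the values prescribed at the two ends agree, so the deformation can be
constant there. -/
lemma deformationValue_of_range (h : i ≫ r = 𝟙 A) {m : SimplexCategoryᵒᵖ} {b : B.obj m}
    (s : Δ[1].obj m) (hb : b ∈ Set.range (i.app m)) : deformationValue i r b s = b := by
  obtain ⟨a, rfl⟩ := hb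
  have : r.app m (i.app m a) = a := ConcreteCategory.congr_hom (NatTrans.congr_app h m) a
  rw [deformationValue, this, ite_self]

lemma map_deformationValue_of_const {m n : SimplexCategoryᵒᵖ} (φ : m ⟶ n) (b : B.obj m)
    (s : Δ[1].obj m) {c : Fin 2} (hc : ∀ k, stdSimplex.asOrderHom s k = c) :
    deformationValue i r (B.map φ b) (Δ[1].map φ s) = B.map φ (deformationValue i r b s) := by
  have hc' (k) : stdSimplex.asOrderHom (Δ[1].map φ s) k = c := hc _
  rw [deformationValue, deformationValue, hc, hc']
  split_ifs
  · rfl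
  · rw [NatTrans.naturality_apply, NatTrans.naturality_apply]

/-- The prescribed deformation stays in the fibres of `r`, so extending it is a lifting problem
against `r`. -/
lemma app_deformationValue (h : i ≫ r = 𝟙 A) {m : SimplexCategoryᵒᵖ} (b : B.obj m)
    (s : Δ[1].obj m) : r.app m (deformationValue i r b s) = r.app m b := by
  have (a : A.obj m) : r.app m (i.app m a) = a := ConcreteCategory.congr_hom (NatTrans.congr_app h m) a
  rw [deformationValue]
  split_ifs
  · rfl
  · rw [this]

/-- The prescribed part of a deformation of `B` onto the image of `i`. -/
noncomputable def deformationBoundary (h : i ≫ r = 𝟙 A) :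
    (deformationSubcomplex i : SSet.{u}) ⟶ B where
  app _ := ↾fun x ↦ deformationValue i r x.1.1 x.1.2
  naturality := by
    rintro m n φ
    ext ⟨⟨b, s⟩, hx⟩
    change deformationValue i r (B.map φ b) (Δ[1].map φ s) = B.map φ (deformationValue i r b s)
    obtain ha | ⟨c, hc⟩ := hx
    · rw [deformationValue_of_range i r h s ha, deformationValue_of_range i r h]
      obtain ⟨a, ha⟩ := ha
      exact ⟨A.map φ a, (NatTrans.naturality_apply i φ a).trans (congr_arg _ ha)⟩
    · exact map_deformationValue_of_const i r φ b s hc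

lemma asOrderHom_eq_one_of_mem_horn {m : SimplexCategoryᵒᵖ} {s : Δ[1].obj m}
    (hs : s ∈ (horn.{u} 1 1).obj m) (k) : stdSimplex.asOrderHom s k = 1 := by
  by_contra hk
  refine hs (Set.eq_univ_iff_forall.2 (fun j ↦ ?_))
  fin_cases j
  · exact Or.inl ⟨k, by
      obtain h | h := Fin.exists_fin_two.1 ⟨stdSimplex.asOrderHom s k, rfl⟩
      · exact h
      · exact absurd h hk⟩
  · exact Or.inr rfl

/-- A section of a map with the right lifting property with respect to monomorphisms is anodyne. -/
lemma anodyneExtensions_of_section (h : i ≫ r = 𝟙 A)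
    (hr : (MorphismProperty.monomorphisms SSet.{u}).rlp r) : anodyneExtensions i := by
  have := hr (deformationSubcomplex i).ι (inferInstanceAs (Mono _))
  -- `sq.lift` is a homotopy from the identity of `B` at the vertex `0` to `r ≫ i` at the vertex
  -- `1`, constant on the range of `i`.
  have sq : CommSq (deformationBoundary i r h) (deformationSubcomplex i).ι r (fst _ _ ≫ r) :=
    ⟨by ext m x; exact app_deformationValue i r h _ _⟩
  have hl {m} (b : B.obj m) (s) (hx : (b, s) ∈ (deformationSubcomplex i).obj m) :
      sq.lift.app m (b, s) = deformationValue i r b s :=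
    ConcreteCategory.congr_hom (NatTrans.congr_app sq.fac_left m) ⟨(b, s), hx⟩
  intro E X p hp
  refine ⟨fun {a b} sq' ↦ ?_⟩
  have hι : anodyneExtensions ((Subcomplex.range i).unionProd Λ[1, 1]).ι :=
    anodyneExtensions_unionProd_ι _ _ (anodyneExtensions.horn_ι 1)
  have := hι p hp
  -- Composed with `b`, the homotopy connects `b` to `r ≫ i ≫ b`, which lifts to `r ≫ a`. Lifting
  -- the homotopy from the end `1`, with constant values over the range of `i`, and restricting it
  -- to the end `0` gives the desired lift.
  have sq₂ : CommSq (((Subcomplex.range i).unionProd Λ[1, 1]).ι ≫ fst _ _ ≫ r ≫ a)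
      ((Subcomplex.range i).unionProd Λ[1, 1]).ι p (sq.lift ≫ b) := by
    refine ⟨?_⟩
    rw [Category.assoc, Category.assoc, Category.assoc, sq'.w]
    ext m ⟨⟨y, s⟩, hx⟩
    refine congr_arg (b.app m) (?_ : i.app m (r.app m y) = sq.lift.app m (y, s))
    obtain hs | hy := (Subcomplex.mem_unionProd_iff _ _ _).1 hx
    · have hs := asOrderHom_eq_one_of_mem_horn hs
      rw [hl _ _ (Or.inr ⟨1, hs⟩), deformationValue, if_neg (by rw [hs]; simp)]
    · rw [hl _ _ (Or.inl hy), deformationValue_of_range i r h s hy]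
      obtain ⟨a, rfl⟩ := hy
      exact congr_arg (i.app m) (ConcreteCategory.congr_hom (NatTrans.congr_app h m) a)
  refine ⟨⟨⟨ι₀ ≫ sq₂.lift, ?_, ?_⟩⟩⟩
  · have h₁ : i ≫ ι₀ = Subcomplex.lift (i ≫ ι₀) (by
        rintro m _ ⟨x, rfl⟩
        exact (Subcomplex.mem_unionProd_iff _ _ _).2 (Or.inr ⟨x, rfl⟩)) ≫
          ((Subcomplex.range i).unionProd Λ[1, 1]).ι := rfl
    rw [← Category.assoc, h₁, Category.assoc, sq₂.fac_left]
    change (i ≫ r) ≫ a = a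
    rw [h, Category.id_comp]
  · rw [Category.assoc, sq₂.fac_right, ← Category.assoc]
    refine Eq.trans (congr_arg (· ≫ b) ?_) (Category.id_comp b)
    ext m x
    refine (hl _ _ (Or.inr ⟨0, fun k ↦ rfl⟩)).trans (if_pos rfl)

lemma rlp_monomorphisms_le_fib : (MorphismProperty.monomorphisms SSet.{u}).rlp ≤ kanQuillen.fib :=
  MorphismProperty.antitone_rlp modelCategoryQuillen.J_le_monomorphisms

lemma weq_of_rlp_monomorphisms {X Y : SSet.{u}} (f : X ⟶ Y)
    (hf : (MorphismProperty.monomorphisms SSet.{u}).rlp f) : kanQuillen.weq f :=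
  ⟨_, 𝟙 _, f, MorphismProperty.of_isIso _ _, hf, Category.id_comp _⟩

/-- If a fibration factors as an anodyne `i` followed by `p`, it lifts against `i`, hence is a
retract of `p`. -/
lemma kanQuillen_weq_inf_fib :
    kanQuillen.{u}.weq ⊓ kanQuillen.fib = (MorphismProperty.monomorphisms SSet.{u}).rlp := by
  refine le_antisymm ?_ (fun _ _ f hf ↦ ⟨weq_of_rlp_monomorphisms f hf,
    rlp_monomorphisms_le_fib f hf⟩)
  rintro X Y f ⟨⟨Z, i, p, hi, hp, fac⟩, hf⟩
  have := hi f hf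
  exact MorphismProperty.of_retract (RetractArrow.ofRightLiftingProperty fac) hp

end SSet

/-! ### Normalized chains and Moore's horn-filling algorithm. -/

namespace SimplicialQMod

open AlgebraicTopology Simplicial Opposite

/-- The normalized chain complex of a simplicial `ℚ`-module. -/
noncomputable abbrev normalized : SimplicialQMod.{u} ⥤ ChQ.{u} :=
  normalizedMooreComplex (ModuleCat.{u} ℚ)

variable (X : SimplicialQMod.{u})

/-- The inclusion of the normalized chains. -/
noncomputable def normalizedι (n : ℕ) : (normalized.obj X).X n ⟶ X _⦋n⦌ :=
  (NormalizedMooreComplex.objX X n).arrow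

instance (n : ℕ) : Mono (normalizedι X n) := inferInstanceAs (Mono (Subobject.arrow _))

variable {X}

lemma normalizedι_injective (n : ℕ) : Function.Injective (normalizedι X n) :=
  (ModuleCat.mono_iff_injective _).1 inferInstance

lemma normalizedι_naturality {Y : SimplicialQMod.{u}} (f : X ⟶ Y) (n : ℕ)
    (x : (normalized.obj X).X n) :
    normalizedι Y n ((normalized.map f).f n x) = f.app (op ⦋n⦌) (normalizedι X n x) := by
  refine ConcreteCategory.congr_hom (?_ : (normalized.map f).f n ≫ normalizedι Y n =
    normalizedι X n ≫ f.app (op ⦋n⦌)) x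
  rw [normalizedMooreComplex_map, NormalizedMooreComplex.map_f]
  exact Subobject.factorThru_arrow (NormalizedMooreComplex.objX Y n) _ _

lemma normalizedι_d (n : ℕ) (x : (normalized.obj X).X (n + 1)) :
    normalizedι X n ((normalized.obj X).d (n + 1) n x) = X.δ 0 (normalizedι X (n + 1) x) := by
  refine ConcreteCategory.congr_hom (?_ : (normalized.obj X).d (n + 1) n ≫ normalizedι X n =
    normalizedι X (n + 1) ≫ X.δ 0) x
  rw [normalizedMooreComplex_objD]
  -- In degree `0` the normalized object is `⊤`, and the differential is defined through the inverse
  -- of its arrow.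
  obtain _ | n := n
  · have h {A B C D : ModuleCat.{u} ℚ} (a : A ⟶ B) (b : B ⟶ C) (c : D ⟶ C) [IsIso c] :
        (a ≫ b ≫ inv c) ≫ c = a ≫ b := by simp
    exact h _ _ (⊤ : Subobject (X _⦋0⦌)).arrow
  · rw [NormalizedMooreComplex.objD]
    exact Subobject.factorThru_arrow (NormalizedMooreComplex.objX X (n + 1)) _ _

lemma δ_succ_normalizedι {n : ℕ} (j : Fin (n + 1)) (x : (normalized.obj X).X (n + 1)) :
    X.δ j.succ (normalizedι X (n + 1) x) = 0 := by
  refine ConcreteCategory.congr_hom (?_ : normalizedι X (n + 1) ≫ X.δ j.succ = 0) x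
  have := Subobject.finset_inf_arrow_factors (Finset.univ)
    (fun k : Fin (n + 1) ↦ kernelSubobject (X.δ k.succ)) j (Finset.mem_univ _)
  change (Subobject.arrow _) ≫ _ = 0
  dsimp only [NormalizedMooreComplex.objX]
  rw [← Subobject.factorThru_arrow _ _ this, Category.assoc, kernelSubobject_arrow_comp, comp_zero]
  rfl

lemma exists_normalizedι_zero_eq (x : X _⦋0⦌) : ∃ y, normalizedι X 0 y = x :=
  (ModuleCat.epi_iff_surjective (normalizedι X 0)).1
    (inferInstanceAs (Epi (⊤ : Subobject (X _⦋0⦌)).arrow)) x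

lemma exists_normalizedι_eq {n : ℕ} {x : X _⦋n + 1⦌} (hx : ∀ j : Fin (n + 1), X.δ j.succ x = 0) :
    ∃ y, normalizedι X (n + 1) y = x := by
  -- The element `x` is viewed as a map from a free module of rank one, to which the factorization
  -- criterion for subobjects applies.
  let t : ModuleCat.of ℚ (ULift.{u} ℚ) ⟶ X _⦋n + 1⦌ :=
    ModuleCat.ofHom ((LinearMap.toSpanSingleton ℚ _ x).comp ULift.moduleEquiv.toLinearMap)
  have ht : t ⟨1⟩ = x := one_smul ℚ x
  have h : (NormalizedMooreComplex.objX X (n + 1)).Factors t := by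
    refine (Subobject.finset_inf_factors _).2 (fun j _ ↦ kernelSubobject_factors _ _ ?_)
    ext ⟨c⟩
    change X.δ j.succ (c • x) = 0
    rw [map_smul, hx, smul_zero]
  exact ⟨Subobject.factorThru _ t h ⟨1⟩,
    (ConcreteCategory.congr_hom (Subobject.factorThru_arrow _ _ h) _).trans ht⟩


section Moore

variable {n : ℕ}

lemma δ_δ_apply {i j : Fin (n + 2)} (h : i ≤ j) (x : X _⦋n + 2⦌) :
    X.δ i (X.δ j.succ x) = X.δ j (X.δ i.castSucc x) :=
  ConcreteCategory.congr_hom (X.δ_comp_δ h) x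

lemma δ_σ_apply_of_le {i : Fin (n + 2)} {j : Fin (n + 1)} (h : i ≤ j.castSucc) (x : X _⦋n + 1⦌) :
    X.δ i.castSucc (X.σ j.succ x) = X.σ j (X.δ i x) :=
  ConcreteCategory.congr_hom (X.δ_comp_σ_of_le h) x

lemma δ_σ_apply_of_gt {i : Fin (n + 2)} {j : Fin (n + 1)} (h : j.castSucc < i) (x : X _⦋n + 1⦌) :
    X.δ i.succ (X.σ j.castSucc x) = X.σ j (X.δ i x) :=
  ConcreteCategory.congr_hom (X.δ_comp_σ_of_gt h) x

lemma δ_σ_apply_self {q : Fin (n + 1)} {r : Fin (n + 2)} (hr : r = q.castSucc ∨ r = q.succ)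
    (x : X _⦋n⦌) : X.δ r (X.σ q x) = x := by
  obtain rfl | rfl := hr
  · exact ConcreteCategory.congr_hom X.δ_comp_σ_self x
  · exact ConcreteCategory.congr_hom X.δ_comp_σ_succ x

/-- The family `x j` for `j ≠ i` satisfies the simplicial identities for the faces of a simplex
with its face opposite to `i` missing. -/
def IsHorn (X : SimplicialQMod.{u}) {n : ℕ} (i : Fin (n + 2)) (x : Fin (n + 2) → X _⦋n⦌) : Prop :=
  match n with
  | 0 => True
  | n + 1 => ∀ a b : Fin (n + 2), a ≤ b → a.castSucc ≠ i → b.succ ≠ i →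
      X.δ b (x a.castSucc) = X.δ a (x b.succ)

/-- Correcting one face of a simplex by a degenerate simplex keeps the other faces. -/
lemma δ_add_σ_of_ne {i : Fin (n + 2)} {x : Fin (n + 2) → X _⦋n⦌} (hx : IsHorn X i x)
    {q : Fin (n + 1)} {r : Fin (n + 2)} (hr : r = q.castSucc ∨ r = q.succ) (hri : r ≠ i)
    {j : Fin (n + 2)} (h₁ : j ≠ q.castSucc) (h₂ : j ≠ q.succ) (hji : j ≠ i) (w : X _⦋n + 1⦌)
    (hw : X.δ j w = x j) : X.δ j (w + X.σ q (x r - X.δ r w)) = x j := by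
  rw [map_add, hw, add_eq_left]
  obtain _ | n := n
  · fin_cases q
    fin_cases j
    · exact absurd rfl h₁
    · exact absurd rfl h₂
  -- In both cases the `j`-th face of the correction is a degeneracy of a face of `x r - X.δ r w`.
  -- That face vanishes by the simplicial identities, because `w` already has the right `j`-th face.
  · obtain hj | hj := lt_or_gt_of_ne h₁
    · obtain ⟨a, rfl⟩ := Fin.eq_castSucc_of_ne_last (Fin.ne_last_of_lt hj)
      obtain ⟨b, rfl⟩ := Fin.exists_succ_eq_of_ne_zero (x := q) (by rintro rfl; simp at hj)
      obtain ⟨c, rfl⟩ := Fin.exists_succ_eq_of_ne_zero (x := r) (by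
        rintro rfl
        simp only [Fin.ext_iff, Fin.val_zero, Fin.val_castSucc, Fin.val_succ] at hr
        omega)
      have hac : a ≤ c := by
        simp only [Fin.lt_def, Fin.le_def, Fin.ext_iff, Fin.val_succ, Fin.val_castSucc] at hj hr ⊢
        omega
      rw [δ_σ_apply_of_le (by
        simp only [Fin.lt_def, Fin.le_def, Fin.val_succ, Fin.val_castSucc] at hj ⊢; omega),
        map_sub, ← hx a c hac hji hri, δ_δ_apply hac, hw, sub_self, map_zero]
    · have hj : q.succ < j := by
        simp only [Fin.lt_def, ne_eq, Fin.ext_iff, Fin.val_succ, Fin.val_castSucc] at *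
        omega
      obtain ⟨a, rfl⟩ := Fin.exists_succ_eq_of_ne_zero (Fin.ne_zero_of_lt hj)
      obtain ⟨b, rfl⟩ := Fin.eq_castSucc_of_ne_last (x := q) (by
        rintro rfl
        simp only [Fin.lt_def, Fin.val_succ, Fin.val_last] at hj
        omega)
      obtain ⟨c, rfl⟩ := Fin.eq_castSucc_of_ne_last (x := r) (by
        rintro rfl
        simp only [Fin.lt_def, Fin.ext_iff, Fin.val_succ, Fin.val_last, Fin.val_castSucc] at *
        omega)
      have hca : c ≤ a := by
        simp only [Fin.lt_def, Fin.le_def, Fin.ext_iff, Fin.val_succ, Fin.val_castSucc] at *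
        omega
      rw [δ_σ_apply_of_gt (by
        simp only [Fin.lt_def, Fin.val_succ, Fin.val_castSucc] at *; omega),
        map_sub, hx c a hca hri hji, ← δ_δ_apply hca, hw, sub_self, map_zero]

lemma δ_add_σ_self {q : Fin (n + 1)} {r : Fin (n + 2)} (hr : r = q.castSucc ∨ r = q.succ)
    (a : X _⦋n⦌) (w : X _⦋n + 1⦌) : X.δ r (w + X.σ q (a - X.δ r w)) = a := by
  rw [map_add, δ_σ_apply_self hr, add_sub_cancel]

/-- Moore's algorithm: horns in a simplicial module can be filled by successive corrections of
any given simplex. -/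
lemma exists_filler {i : Fin (n + 2)} {x : Fin (n + 2) → X _⦋n⦌} (hx : IsHorn X i x)
    (P : X _⦋n + 1⦌ → Prop)
    (hP : ∀ w q r, r ≠ i → P w → P (w + X.σ q (x r - X.δ r w))) {w₀ : X _⦋n + 1⦌} (h₀ : P w₀) :
    ∃ w, P w ∧ ∀ j, j ≠ i → X.δ j w = x j := by
  -- The faces below `i` are corrected in increasing order, the `r`-th one by means of `σ r`.
  have h₁ (r : ℕ) (hr : r ≤ i) : ∃ w, P w ∧ ∀ j : Fin (n + 2), (j : ℕ) < r → X.δ j w = x j := by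
    induction r with
    | zero => exact ⟨w₀, h₀, by simp⟩
    | succ r ih =>
      obtain ⟨w, hw, hw'⟩ := ih (by omega)
      let q : Fin (n + 1) := ⟨r, by omega⟩
      have hq : q.castSucc ≠ i := fun h ↦ by
        have : r = i := congr_arg Fin.val h
        omega
      refine ⟨_, hP w q q.castSucc hq hw, fun j hj ↦ ?_⟩
      obtain hj | hj := (Nat.lt_succ_iff_lt_or_eq.1 hj)
      · refine δ_add_σ_of_ne hx (Or.inl rfl) hq ?_ ?_ ?_ w (hw' j hj) <;>
          simp only [q, ne_eq, Fin.ext_iff, Fin.val_succ, Fin.val_castSucc] <;> omega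
      · rw [show j = q.castSucc from Fin.ext hj]
        exact δ_add_σ_self (Or.inl rfl) _ _
  -- The faces above `i` are corrected from the last one downwards; the face `n + 1 - t` uses the
  -- degeneracy `n - t`, so the faces already corrected are kept.
  have h₂ (t : ℕ) (ht : t ≤ n + 1 - i) : ∃ w, P w ∧ ∀ j : Fin (n + 2),
      ((j : ℕ) < i ∨ n + 1 - t < j) → X.δ j w = x j := by
    induction t with
    | zero =>
      obtain ⟨w, hw, hw'⟩ := h₁ i le_rfl
      exact ⟨w, hw, fun j hj ↦ hw' j (by omega)⟩
    | succ t ih =>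
      obtain ⟨w, hw, hw'⟩ := ih (by omega)
      let q : Fin (n + 1) := ⟨n - t, by omega⟩
      have hq : q.succ ≠ i := fun h ↦ by
        have : n - t + 1 = i := congr_arg Fin.val h
        omega
      refine ⟨_, hP w q q.succ hq hw, fun j hj ↦ ?_⟩
      by_cases hjq : j = q.succ
      · rw [hjq]
        exact δ_add_σ_self (Or.inr rfl) _ _
      · simp only [q, Fin.ext_iff, Fin.val_succ] at hjq
        refine δ_add_σ_of_ne hx (Or.inr rfl) hq ?_ ?_ ?_ w (hw' j (by omega)) <;>
          simp only [q, ne_eq, Fin.ext_iff, Fin.val_succ, Fin.val_castSucc] <;> omega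
  obtain ⟨w, hw, hw'⟩ := h₂ (n + 1 - i) le_rfl
  exact ⟨w, hw, fun j hj ↦ hw' j (by have := Fin.val_ne_of_ne hj; omega)⟩

end Moore

end SimplicialQMod

/-! ### Kan fibrations in terms of families of faces. -/

namespace SSet

open Simplicial Opposite

/-- The family `x j` for `j ≠ i` satisfies the simplicial identities for the faces of a simplex
with its face opposite to `i` missing. -/
def IsHorn (X : SSet.{u}) {n : ℕ} (i : Fin (n + 2)) (x : Fin (n + 2) → X _⦋n⦌) : Prop :=
  match n with
  | 0 => True
  | n + 1 => ∀ a b : Fin (n + 2), a ≤ b → a.castSucc ≠ i → b.succ ≠ i →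
      X.δ b (x a.castSucc) = X.δ a (x b.succ)

lemma isHorn_iff {X : SSet.{u}} {n : ℕ} {i : Fin (n + 2)} {x : Fin (n + 2) → X _⦋n⦌} :
    X.IsHorn i x ↔ horn.IsCompatible (fun j (_ : j ≠ i) ↦ yonedaEquiv.symm (x j)) := by
  obtain _ | n := n
  · rfl
  · simp only [IsHorn, horn.isCompatible_iff, stdSimplex.δ_comp_yonedaEquiv_symm,
      EmbeddingLike.apply_eq_iff_eq]
    refine ⟨fun h j k hj hk hjk ↦ ?_, fun h a b hab ha hb ↦
      by simpa using h a.castSucc b.succ ha hb (Fin.castSucc_lt_succ_iff.2 hab)⟩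
    obtain ⟨a, rfl⟩ := Fin.eq_castSucc_of_ne_last (Fin.ne_last_of_lt hjk)
    obtain ⟨b, rfl⟩ := Fin.eq_succ_of_ne_zero (Fin.ne_zero_of_lt hjk)
    simpa using h a b (Fin.castSucc_lt_succ_iff.1 hjk) hj hk

/-- Kan fibrations in terms of simplices. -/
lemma kanQuillen_fib_iff {E B : SSet.{u}} (p : E ⟶ B) : kanQuillen.fib p ↔
    ∀ (n : ℕ) (i : Fin (n + 2)) (x : Fin (n + 2) → E _⦋n⦌) (y : B _⦋n + 1⦌), E.IsHorn i x →
      (∀ j, j ≠ i → p.app _ (x j) = B.δ j y) →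
      ∃ w, (∀ j, j ≠ i → E.δ j w = x j) ∧ p.app _ w = y := by
  refine ⟨fun hp n i x y hx hy ↦ ?_, fun h _ _ i hi ↦ ?_⟩
  · let φ := (isHorn_iff.1 hx).desc
    have hφ (j) (hj : j ≠ i) : horn.ι i j hj ≫ φ = yonedaEquiv.symm (x j) :=
      horn.IsCompatible.ι_desc _ _ _
    have sq : CommSq φ Λ[n + 1, i].ι p (yonedaEquiv.symm y) := ⟨horn.hom_ext' (fun j hj ↦ by
      rw [reassoc_of% hφ, reassoc_of% horn.ι_ι, yonedaEquiv_symm_comp,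
        stdSimplex.δ_comp_yonedaEquiv_symm, hy j hj])⟩
    have := hp _ (modelCategoryQuillen.horn_ι_mem_J (n + 1) i)
    refine ⟨yonedaEquiv sq.lift, fun j hj ↦ ?_, ?_⟩
    · rw [← stdSimplex.yonedaEquiv_δ_comp, ← horn.ι_ι i j hj, Category.assoc, sq.fac_left, hφ,
        Equiv.apply_symm_apply]
    · rw [← yonedaEquiv_comp, sq.fac_right, Equiv.apply_symm_apply]
  · simp only [modelCategoryQuillen.J, MorphismProperty.iSup_iff] at hi
    obtain ⟨n, ⟨i⟩⟩ := hi
    refine ⟨fun {t b} sq ↦ ?_⟩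
    -- The value at the missing face `i` is irrelevant, but some `n`-simplex of `E` is needed there;
    -- it is made from another face of the horn.
    have : ∃ x : Fin (n + 2) → E _⦋n⦌, ∀ j (hj : j ≠ i), x j = yonedaEquiv (horn.ι i j hj ≫ t) := by
      refine ⟨fun j ↦ if hj : j ≠ i then yonedaEquiv (horn.ι i j hj ≫ t) else
        E.map (SimplexCategory.const ⦋n⦌ ⦋n + 1⦌ 0).op
          (E.σ 0 (yonedaEquiv (horn.ι i (exists_ne i).choose (exists_ne i).choose_spec ≫ t))),
        fun j hj ↦ dif_pos hj⟩
    obtain ⟨x, hx⟩ := this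
    have hx' (j) (hj : j ≠ i) : yonedaEquiv.symm (x j) = horn.ι i j hj ≫ t := by
      rw [hx j hj, Equiv.symm_apply_apply]
    obtain ⟨w, hw, hw'⟩ := h n i x (yonedaEquiv b) (isHorn_iff.2 (by
      rw [show (fun j (_ : j ≠ i) ↦ yonedaEquiv.symm (x j)) = fun j hj ↦ horn.ι i j hj ≫ t from
        funext fun j ↦ funext (hx' j)]
      exact horn.IsCompatible.of_hom t)) (fun j hj ↦ by
        rw [← stdSimplex.yonedaEquiv_δ_comp, ← horn.ι_ι i j hj, Category.assoc, ← sq.w,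
          hx j hj, ← yonedaEquiv_comp, Category.assoc])
    refine ⟨⟨⟨yonedaEquiv.symm w, horn.hom_ext' (fun j hj ↦ ?_), ?_⟩⟩⟩
    · rw [reassoc_of% horn.ι_ι, stdSimplex.δ_comp_yonedaEquiv_symm, hw j hj, hx']
    · rw [yonedaEquiv_symm_comp, hw', Equiv.symm_apply_apply]

end SSet

/-! ### Kan fibrations of simplicial modules and surjectivity on normalized chains. -/

namespace SimplicialQMod

open AlgebraicTopology Simplicial Opposite SSet

variable {X Y : SimplicialQMod.{u}} (f : X ⟶ Y)

/-- The degenerate simplices on a vertex. -/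
def degenerate (X : SimplicialQMod.{u}) (n : ℕ) : X _⦋0⦌ ⟶ X _⦋n⦌ :=
  X.map (SimplexCategory.const ⦋n⦌ ⦋0⦌ 0).op

lemma map_degenerate {m n : ℕ} (φ : ⦋m⦌ ⟶ ⦋n⦌) (x : X _⦋0⦌) :
    X.map φ.op (degenerate X n x) = degenerate X m x := by
  refine ConcreteCategory.congr_hom (?_ : degenerate X n ≫ X.map φ.op = degenerate X m) x
  exact (X.map_comp _ _).symm

lemma map_degenerate_to_zero {n : ℕ} (φ : ⦋0⦌ ⟶ ⦋n⦌) (x : X _⦋0⦌) :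
    X.map φ.op (degenerate X n x) = x := by
  rw [map_degenerate]
  have : SimplexCategory.const ⦋0⦌ ⦋0⦌ 0 = 𝟙 _ := by
    ext x; exact congr_arg Fin.val (Subsingleton.elim (α := Fin 1) _ _)
  exact ConcreteCategory.congr_hom ((congr_arg (fun φ ↦ X.map φ.op) this).trans (X.map_id _)) x

/-- Moore's algorithm on the zero horn reduces `y` to a normalized chain, which lies in the image in
positive degrees. The terms removed are degeneracies of simplices of lower dimension, handled by
induction, and only a totally degenerate term remains. -/
lemma exists_eq_add_degenerate (hf : ChQ.posSurj (normalized.map f)) (n : ℕ) (y : Y _⦋n⦌) :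
    ∃ x y₀, f.app _ x + degenerate Y n y₀ = y := by
  induction n with
  | zero =>
    exact ⟨0, y, by
      rw [map_zero, zero_add]
      exact (map_degenerate (𝟙 _) y).symm.trans (map_degenerate_to_zero (𝟙 _) y)⟩
  | succ n ih =>
    obtain ⟨w, ⟨x, y₀, hw⟩, hw'⟩ := exists_filler (X := Y) (i := (0 : Fin (n + 2))) (x := 0)
      (by obtain _ | n := n; · trivial
          · intro a b _ _ _; exact (map_zero _).trans (map_zero _).symm)
      (fun w ↦ ∃ x y₀, f.app _ x + degenerate Y (n + 1) y₀ = y - w) (fun w q r _ ↦ by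
        rintro ⟨x, y₀, hw⟩
        obtain ⟨x', y₀', hx'⟩ := ih (Y.δ r w)
        refine ⟨x + X.σ q x', y₀ + y₀', ?_⟩
        have h₁ : f.app _ (X.σ q x') = Y.σ q (f.app _ x') := NatTrans.naturality_apply f _ _
        have h₂ : degenerate Y _ y₀' = Y.σ q (degenerate Y _ y₀') := (map_degenerate _ _).symm
        rw [map_add, map_add, h₁, h₂, add_add_add_comm, hw, ← map_add, hx', Pi.zero_apply,
          zero_sub, map_neg]
        abel) (w₀ := y) ⟨0, 0, by simp⟩
    obtain ⟨z, rfl⟩ := exists_normalizedι_eq (fun j ↦ hw' _ (Fin.succ_ne_zero j))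
    obtain ⟨z, rfl⟩ := hf _ n.succ_pos z
    refine ⟨x + normalizedι X _ z, y₀, ?_⟩
    rw [map_add, ← normalizedι_naturality, add_right_comm, hw, sub_add_cancel]

/-- If some vertex of `y` is in the image of `f`, then so is `y`. -/
lemma exists_eq_of_vertex (hf : ChQ.posSurj (normalized.map f)) {n : ℕ} (y : Y _⦋n⦌)
    (φ : ⦋0⦌ ⟶ ⦋n⦌) (x₀ : X _⦋0⦌) (h : f.app _ x₀ = Y.map φ.op y) : ∃ x, f.app _ x = y := by
  obtain ⟨x, y₀, rfl⟩ := exists_eq_add_degenerate f hf n y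
  rw [map_add, map_degenerate_to_zero, ← NatTrans.naturality_apply] at h
  obtain rfl : f.app _ (x₀ - X.map φ.op x) = y₀ := by rw [map_sub, h, add_sub_cancel_left]
  refine ⟨x + degenerate X n (x₀ - X.map φ.op x), ?_⟩
  rw [map_add]
  exact congr_arg _ (NatTrans.naturality_apply f _ _)

/-- A map of simplicial `ℚ`-modules that is surjective on normalized chains in positive degrees
is a Kan fibration. -/
lemma fib_of_posSurj (hf : ChQ.posSurj (normalized.map f)) : kanQuillen.fib (toSSet.map f) := by
  refine (kanQuillen_fib_iff _).2 (fun n i (x : _ → X _⦋n⦌) (y : Y _⦋n + 1⦌) hx hy ↦ ?_)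
  replace hx : IsHorn X i x := by obtain _ | n := n; exacts [trivial, hx]
  replace hy (j) (hj : j ≠ i) : f.app _ (x j) = Y.δ j y := hy j hj
  obtain ⟨w₀, hw₀⟩ : ∃ w, f.app _ w = y := by
    obtain ⟨j, hj⟩ := exists_ne i
    refine exists_eq_of_vertex f hf y (SimplexCategory.const ⦋0⦌ ⦋n⦌ 0 ≫ SimplexCategory.δ j)
      (X.map (SimplexCategory.const ⦋0⦌ ⦋n⦌ 0).op (x j)) ?_
    rw [NatTrans.naturality_apply, hy j hj]
    exact ConcreteCategory.congr_hom (Y.map_comp _ _).symm y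
  -- Moore's corrections stay over `y`: the terms `x r - X.δ r w` lie in the kernel of `f`, both
  -- members having image `Y.δ r y`.
  obtain ⟨w, hw, hw'⟩ := exists_filler hx (fun w ↦ f.app _ w = y) (fun w q r hr hw ↦ by
    have h₁ (a) : f.app _ (X.σ q a) = Y.σ q (f.app _ a) := NatTrans.naturality_apply f _ _
    have h₂ (a) : f.app _ (X.δ r a) = Y.δ r (f.app _ a) := NatTrans.naturality_apply f _ _
    rw [map_add, h₁, map_sub, hy r hr, h₂, hw, sub_self, map_zero, add_zero]) hw₀
  exact ⟨w, hw', hw⟩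

/-- A map of simplicial `ℚ`-modules that is a Kan fibration is surjective on normalized chains
in positive degrees. -/
lemma posSurj_of_fib (hf : kanQuillen.fib (toSSet.map f)) : ChQ.posSurj (normalized.map f) := by
  intro n hn y
  obtain ⟨n, rfl⟩ := Nat.exists_eq_succ_of_ne_zero hn.ne'
  have hx : IsHorn X (n := n) 0 0 := by
    obtain _ | n := n
    · trivial
    · intro a b _ _ _
      exact (map_zero _).trans (map_zero _).symm
  -- A normalized chain lies over the zero horn missing the face `0`, and any filler of that horn is
  -- itself normalized.
  obtain ⟨w, hw, hw'⟩ := (kanQuillen_fib_iff _).1 hf n 0 (0 : Fin (n + 2) → X _⦋n⦌) (normalizedι Y _ y)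
    (by obtain _ | n := n; exacts [trivial, hx]) (fun j hj ↦ by
      obtain ⟨j, rfl⟩ := Fin.eq_succ_of_ne_zero hj
      exact (map_zero (f.app _).hom).trans (δ_succ_normalizedι j y).symm)
  obtain ⟨x, rfl⟩ := exists_normalizedι_eq (X := X) (x := w) (fun j ↦ hw _ (Fin.succ_ne_zero j))
  exact ⟨x, normalizedι_injective _ ((normalizedι_naturality f _ x).trans hw')⟩

end SimplicialQMod

/-! ### Transport of model structures along equivalences. -/

lemma CategoryTheory.HasLiftingProperty.of_map {C D : Type*} [Category* C] [Category* D] (F : C ⥤ D)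
    [F.Full] [F.Faithful] {A B X Y : C} (i : A ⟶ B) (p : X ⟶ Y)
    [HasLiftingProperty (F.map i) (F.map p)] : HasLiftingProperty i p where
  sq_hasLift sq := ⟨⟨⟨F.preimage (sq.map F).lift,
    F.map_injective (by rw [F.map_comp, F.map_preimage, CommSq.fac_left]),
    F.map_injective (by rw [F.map_comp, F.map_preimage, CommSq.fac_right])⟩⟩⟩

namespace CategoryTheory.MorphismProperty

variable {C D : Type*} [Category* C] [Category* D] (e : C ≌ D) {W₁ W₂ : MorphismProperty D}

lemma _root_.CategoryTheory.Equivalence.unit_inverse_map_naturality {A B : C} {Z Z' : D} (x : A ⟶ B)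
    {i : e.functor.obj A ⟶ Z} {i' : e.functor.obj B ⟶ Z'} {z : Z ⟶ Z'}
    (h : e.functor.map x ≫ i' = i ≫ z) :
    x ≫ e.unit.app B ≫ e.inverse.map i' =
      (e.unit.app A ≫ e.inverse.map i) ≫ e.inverse.map z := by
  rw [Category.assoc, ← e.inverse.map_comp, ← h, e.inverse.map_comp]
  simp

lemma _root_.CategoryTheory.Equivalence.inverse_map_unitInv_naturality {A B : C} {Z Z' : D}
    (x : A ⟶ B) {p : Z ⟶ e.functor.obj A} {p' : Z' ⟶ e.functor.obj B} {z : Z ⟶ Z'}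
    (h : z ≫ p' = p ≫ e.functor.map x) :
    e.inverse.map z ≫ e.inverse.map p' ≫ e.unitInv.app B =
      (e.inverse.map p ≫ e.unitInv.app A) ≫ x := by
  rw [← e.inverse.map_comp_assoc, h, e.inverse.map_comp_assoc, Category.assoc]
  simp

lemma _root_.CategoryTheory.Equivalence.unit_inverse_map_fac {A B : C} {Z : D} {x : A ⟶ B}
    {i : e.functor.obj A ⟶ Z} {p : Z ⟶ e.functor.obj B} (h : i ≫ p = e.functor.map x) :
    (e.unit.app A ≫ e.inverse.map i) ≫ e.inverse.map p ≫ e.unitInv.app B = x := by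
  rw [Category.assoc, ← e.inverse.map_comp_assoc, h]
  simp

lemma inverseImage_unit_inverse_map [W₁.RespectsIso] {A : C} {Z : D} {i : e.functor.obj A ⟶ Z}
    (hi : W₁ i) : W₁.inverseImage e.functor (e.unit.app A ≫ e.inverse.map i) := by
  refine (W₁.arrow_mk_iso_iff (Arrow.isoMk' i (e.functor.map (e.unit.app A ≫ e.inverse.map i)) (Iso.refl _)
    (e.counitIso.app _).symm ?_)).1 hi
  simp

lemma inverseImage_inverse_map_unitInv [W₁.RespectsIso] {A : C} {Z : D} {p : Z ⟶ e.functor.obj A}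
    (hp : W₁ p) : W₁.inverseImage e.functor (e.inverse.map p ≫ e.unitInv.app A) := by
  refine (W₁.arrow_mk_iso_iff (Arrow.isoMk' p (e.functor.map (e.inverse.map p ≫ e.unitInv.app A))
    (e.counitIso.app _).symm (Iso.refl _) ?_)).1 hp
  simp

/-- Functorial factorizations are transported along equivalences of categories. -/
noncomputable def FunctorialFactorizationData.inverseImage (d : FunctorialFactorizationData W₁ W₂)
    [W₁.RespectsIso] [W₂.RespectsIso] :
    FunctorialFactorizationData (W₁.inverseImage e.functor) (W₂.inverseImage e.functor) where
  Z := e.functor.mapArrow ⋙ d.Z ⋙ e.inverse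
  i :=
    { app f := e.unit.app f.left ≫ e.inverse.map (d.i.app (e.functor.mapArrow.obj f))
      naturality f g φ := e.unit_inverse_map_naturality φ.left
        (d.i.naturality (e.functor.mapArrow.map φ)) }
  p :=
    { app f := e.inverse.map (d.p.app (e.functor.mapArrow.obj f)) ≫ e.unitInv.app f.right
      naturality f g φ := e.inverse_map_unitInv_naturality φ.right
        (d.p.naturality (e.functor.mapArrow.map φ)) }
  fac := by
    ext f
    exact e.unit_inverse_map_fac (NatTrans.congr_app d.fac (e.functor.mapArrow.obj f))
  hi f := inverseImage_unit_inverse_map e (d.hi (e.functor.mapArrow.obj f))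
  hp f := inverseImage_inverse_map_unitInv e (d.hp (e.functor.mapArrow.obj f))

end CategoryTheory.MorphismProperty

namespace ModelClasses

variable {C : Type*} {D : Type*} [Category* C] [Category* D]

/-- The inverse image of three classes of morphisms under a functor. -/
def inverseImage (M : ModelClasses D) (F : C ⥤ D) : ModelClasses C where
  weq := M.weq.inverseImage F
  cof := M.cof.inverseImage F
  fib := M.fib.inverseImage F

lemma IsFunctorialModel.inverseImage {M : ModelClasses D} (hM : M.IsFunctorialModel) (e : C ≌ D) :
    (M.inverseImage e.functor).IsFunctorialModel := by
  have := hM.two_out_of_three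
  have := hM.weq_retracts
  have := hM.fib_retracts
  have := hM.cof_retracts
  exact
  { two_out_of_three := inferInstanceAs (M.weq.inverseImage e.functor).HasTwoOutOfThreeProperty
    weq_retracts := inferInstanceAs (M.weq.inverseImage e.functor).IsStableUnderRetracts
    fib_retracts := inferInstanceAs (M.fib.inverseImage e.functor).IsStableUnderRetracts
    cof_retracts := inferInstanceAs (M.cof.inverseImage e.functor).IsStableUnderRetracts
    lift_weq_cof i p hi hi' hp := by
      have := hM.lift_weq_cof _ _ hi hi' hp
      exact .of_map e.functor i p
    lift_weq_fib i p hi hp hp' := by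
      have := hM.lift_weq_fib _ _ hi hp hp'
      exact .of_map e.functor i p
    factorization_weq_cof :=
      ⟨⟨hM.factorization_weq_cof.nonempty_functorialFactorizationData.some.inverseImage e⟩⟩
    factorization_weq_fib :=
      ⟨⟨hM.factorization_weq_fib.nonempty_functorialFactorizationData.some.inverseImage e⟩⟩ }

end ModelClasses

/-! ### Comparison of the transported and simplicial weak equivalences. -/

namespace SimplicialQMod

open AlgebraicTopology Simplicial Opposite SSet

/-- The free `ℚ`-module on a type. -/
noncomputable def freeModule : Type u ⥤ ModuleCat.{u} ℚ where
  obj S := ModuleCat.of ℚ (S →₀ ℚ)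
  map f := ModuleCat.ofHom (Finsupp.lmapDomain ℚ ℚ f)
  map_id _ := ModuleCat.hom_ext (Finsupp.lmapDomain_id ℚ ℚ)
  map_comp f g := ModuleCat.hom_ext (Finsupp.lmapDomain_comp ℚ ℚ f g)

/-- The basis elements of a free module. -/
noncomputable def freeModuleMk {S : Type u} (s : S) : freeModule.obj S := (Finsupp.single s 1 : S →₀ ℚ)

lemma freeModule_map_mk {S T : Type u} (f : S ⟶ T) (s : S) :
    freeModule.map f (freeModuleMk s) = freeModuleMk (f s) :=
  Finsupp.mapDomain_single

lemma freeModule_hom_ext {S : Type u} {M : ModuleCat.{u} ℚ} {φ ψ : freeModule.obj S ⟶ M}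
    (h : ∀ s, φ (freeModuleMk s) = ψ (freeModuleMk s)) : φ = ψ :=
  ModuleCat.hom_ext (Finsupp.lhom_ext' fun s ↦ LinearMap.ext_ring (h s))

/-- The morphism from a free module given by the images of the basis elements. -/
noncomputable def freeModuleDesc {S : Type u} {M : ModuleCat.{u} ℚ} (f : S → M) :
    freeModule.obj S ⟶ M :=
  ModuleCat.ofHom (X := S →₀ ℚ) (Finsupp.lift M ℚ S f)

lemma freeModuleDesc_mk {S : Type u} {M : ModuleCat.{u} ℚ} (f : S → M) (s : S) :
    freeModuleDesc f (freeModuleMk s) = f s :=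
  (Finsupp.sum_single_index (zero_smul ℚ (f s))).trans (one_smul ℚ (f s))

/-- Free `ℚ`-modules are left adjoint to the forgetful functor. -/
noncomputable def freeModuleAdj : freeModule.{u} ⊣ forget (ModuleCat.{u} ℚ) :=
  Adjunction.mkOfHomEquiv
    { homEquiv S M :=
        { toFun φ := ↾fun s ↦ φ (freeModuleMk s)
          invFun ψ := freeModuleDesc ψ
          left_inv φ := freeModule_hom_ext (fun s ↦ freeModuleDesc_mk _ s)
          right_inv ψ := by
            ext s
            exact freeModuleDesc_mk _ s }
      homEquiv_naturality_left_symm f g := freeModule_hom_ext (fun s ↦ by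
        refine (freeModuleDesc_mk _ s).trans ?_
        refine (freeModuleDesc_mk g (f s)).symm.trans ?_
        exact congr_arg (freeModuleDesc g) (freeModule_map_mk f s).symm)
      homEquiv_naturality_right f g := rfl }

instance : freeModule.{u}.PreservesMonomorphisms where
  preserves f _ := (ModuleCat.mono_iff_injective _).2
    (Finsupp.mapDomain_injective ((mono_iff_injective f).1 inferInstance))

/-- The free simplicial `ℚ`-module on a simplicial set. -/
noncomputable def free : SSet.{u} ⥤ SimplicialQMod.{u} :=
  (Functor.whiskeringRight _ _ _).obj freeModule

/-- Free simplicial `ℚ`-modules are left adjoint to the forgetful functor. -/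
noncomputable def freeAdj : free.{u} ⊣ toSSet.{u} := Adjunction.whiskerRight _ freeModuleAdj

instance : free.{u}.PreservesMonomorphisms where
  preserves f _ := by
    have (n : SimplexCategoryᵒᵖ) : Mono ((free.map f).app n) := inferInstanceAs (Mono (freeModule.map (f.app n)))
    exact NatTrans.mono_of_mono_app _

/-- The model structure transported from chain complexes. -/
noncomputable abbrev transported : ModelClasses SimplicialQMod.{u} := chQModel.inverseImage normalized

lemma transported_isFunctorialModel : transported.{u}.IsFunctorialModel :=
  chQModel_isFunctorialModel.inverseImage Abelian.DoldKan.equivalence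

instance : normalized.{u}.IsEquivalence :=
  inferInstanceAs (Abelian.DoldKan.equivalence (A := ModuleCat.{u} ℚ)).functor.IsEquivalence

variable {X Y : SimplicialQMod.{u}} (f : X ⟶ Y)

lemma transported_weq_id (X : SimplicialQMod.{u}) : transported.weq (𝟙 X) := by
  change QuasiIso (normalized.map (𝟙 X))
  rw [normalized.map_id]
  infer_instance

lemma transported_fib_iff : transported.fib f ↔ kanQuillen.fib (toSSet.map f) :=
  ⟨fib_of_posSurj f, posSurj_of_fib f⟩

/-- By adjunction the problem is to lift `free.map i` against `f`. Free modules preserve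
monomorphisms, and the lift exists after passing to chain complexes. -/
lemma rlp_monomorphisms_of_transported (hf : transported.fib f) (hf' : transported.weq f) :
    (MorphismProperty.monomorphisms SSet.{u}).rlp (toSSet.map f) := by
  intro A B i (_ : Mono i)
  rw [← freeAdj.hasLiftingProperty_iff]
  have : QuasiIso (normalized.map f) := hf'
  have := ChQ.hasLiftingProperty_of_mono (normalized.map (free.map i)) (normalized.map f) hf
  exact .of_map normalized _ _

lemma transported_fib_of_section {f : X ⟶ Y} {s : Y ⟶ X} (h : s ≫ f = 𝟙 Y) :
    transported.fib f := fun n _ y ↦ ⟨(normalized.map s).f n y, by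
  refine ConcreteCategory.congr_hom (?_ : (normalized.map s).f n ≫ (normalized.map f).f n = 𝟙 _) y
  rw [← HomologicalComplex.comp_f, ← normalized.map_comp, h, normalized.map_id,
    HomologicalComplex.id_f]⟩

/-- Every object is fibrant, so the acyclic cofibration `d.i` in a factorization of `f` has a
retraction. That retraction is a split epimorphism and a weak equivalence, hence an acyclic
fibration, and its section `d.i` is anodyne on simplicial sets. -/
lemma weq_of_transported (hf : transported.weq f) : kanQuillen.weq (toSSet.map f) := by
  have := transported_isFunctorialModel.{u}.two_out_of_three
  have := transported_isFunctorialModel.{u}.factorization_weq_cof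
  let d := MorphismProperty.factorizationData (transported.{u}.cof ⊓ transported.weq)
    transported.fib f
  have hp : transported.weq d.p :=
    transported.weq.of_precomp _ _ d.hi.2 (by rwa [d.fac])
  have := transported_isFunctorialModel.lift_weq_cof d.i (terminal.from X) d.hi.1 d.hi.2
    (transported_fib_of_section (s := 0) (Subsingleton.elim _ _))
  have sq : CommSq (𝟙 X) d.i (terminal.from X) (terminal.from _) := ⟨Subsingleton.elim _ _⟩
  have hr : transported.weq sq.lift := by
    refine transported.weq.of_precomp _ _ d.hi.2 ?_
    rw [sq.fac_left]
    exact transported_weq_id _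
  refine ⟨_, toSSet.map d.i, toSSet.map d.p, ?_, rlp_monomorphisms_of_transported _ d.hp hp, ?_⟩
  · refine anodyneExtensions_of_section _ (toSSet.map sq.lift) ?_
      (rlp_monomorphisms_of_transported _ (transported_fib_of_section sq.fac_left) hr)
    rw [← toSSet.map_comp, sq.fac_left, toSSet.map_id]
  · rw [← toSSet.map_comp, d.fac]

/-- By adjunction `free.map i` lifts against fibrations, so it is a retract of the acyclic
cofibration in its factorization. -/
lemma transported_weq_free_of_anodyneExtensions {A B : SSet.{u}} (i : A ⟶ B)
    (hi : anodyneExtensions i) : transported.weq (free.map i) := by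
  have := transported_isFunctorialModel.{u}.factorization_weq_cof
  have := transported_isFunctorialModel.{u}.weq_retracts
  let d := MorphismProperty.factorizationData (transported.{u}.cof ⊓ transported.weq)
    transported.fib (free.map i)
  have := (freeAdj.hasLiftingProperty_iff i d.p).2 (hi _ ((transported_fib_iff _).1 d.hp))
  exact MorphismProperty.of_retract (RetractArrow.ofLeftLiftingProperty d.fac) d.hi.2

/-- An acyclic fibration `p` has a section, which is anodyne; the previous case and two-out-of-three
then settle `free.map p`. -/
lemma transported_weq_free {A B : SSet.{u}} (f : A ⟶ B) (hf : kanQuillen.weq f) :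
    transported.weq (free.map f) := by
  have := transported_isFunctorialModel.{u}.two_out_of_three
  obtain ⟨Z, i, p, hi, hp, rfl⟩ := hf
  have := hp (initial.to B) inferInstance
  have sq : CommSq (initial.to Z) (initial.to B) p (𝟙 B) := ⟨Subsingleton.elim _ _⟩
  have h₁ := transported_weq_free_of_anodyneExtensions _
    (anodyneExtensions_of_section sq.lift p sq.fac_right hp)
  have h₂ : transported.weq (free.map p) := by
    refine transported.weq.of_precomp _ _ h₁ ?_
    rw [← free.map_comp, sq.fac_right, free.map_id]
    exact transported_weq_id _
  rw [free.map_comp]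
  exact transported.weq.comp_mem _ _ (transported_weq_free_of_anodyneExtensions i hi) h₂

section

variable (X)

/-- The difference between a basis element and the basis element of `0`. -/
noncomputable def freeDiff {n : SimplexCategoryᵒᵖ} (x : X.obj n) :
    (free.obj (toSSet.obj X)).obj n :=
  freeModuleMk (S := X.obj n) x - freeModuleMk (S := X.obj n) 0

lemma freeDiff_zero (n : SimplexCategoryᵒᵖ) : freeDiff X (0 : X.obj n) = 0 := sub_self _

lemma map_freeDiff {m n : SimplexCategoryᵒᵖ} (φ : m ⟶ n) (x : X.obj m) :
    (free.obj (toSSet.obj X)).map φ (freeDiff X x) = freeDiff X (X.map φ x) := by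
  refine (map_sub _ _ _).trans (congr_arg₂ _ (freeModule_map_mk _ _)
    ((freeModule_map_mk _ _).trans (congr_arg _ (map_zero (X.map φ).hom))))

variable {X} in
lemma free_map_freeDiff {n : SimplexCategoryᵒᵖ} (x : X.obj n) :
    (free.map (toSSet.map f)).app n (freeDiff X x) = freeDiff Y (f.app n x) := by
  refine (map_sub _ _ _).trans (congr_arg₂ _ (freeModule_map_mk _ _)
    ((freeModule_map_mk _ _).trans (congr_arg _ (map_zero (f.app n).hom))))

lemma counit_freeDiff {n : SimplexCategoryᵒᵖ} (x : X.obj n) :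
    (freeAdj.counit.app X).app n (freeDiff X x) = x := by
  have h (x : X.obj n) :
      (freeAdj.counit.app X).app n (freeModuleMk (S := X.obj n) x) = x := by
    have : freeAdj.counit.app X = (Adjunction.whiskerRight _ freeModuleAdj).counit.app X := rfl
    rw [this]
    exact freeModuleDesc_mk (𝟙 ((forget _).obj (X.obj n))) x
  exact (map_sub _ _ _).trans (by rw [h, h, sub_zero])

/-- Subtracting the basis element of `0` makes `freeDiff` preserve zero; as it commutes with faces,
vanishing faces stay zero. -/
lemma exists_normalized_freeDiff {n : ℕ} (x : (normalized.obj X).X n) :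
    ∃ y, normalizedι (free.obj (toSSet.obj X)) n y = freeDiff X (normalizedι X n x) := by
  obtain _ | n := n
  · exact exists_normalizedι_zero_eq _
  · exact exists_normalizedι_eq (fun j ↦ (map_freeDiff X _ _).trans
      ((congr_arg _ (δ_succ_normalizedι j x)).trans (freeDiff_zero _ _)))

/-- The nonlinear natural section of the counit on normalized chains. -/
noncomputable def normalizedSection {n : ℕ} (x : (normalized.obj X).X n) :
    (normalized.obj (free.obj (toSSet.obj X))).X n :=
  (exists_normalized_freeDiff X x).choose

lemma normalizedι_normalizedSection {n : ℕ} (x : (normalized.obj X).X n) :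
    normalizedι _ n (normalizedSection X x) = freeDiff X (normalizedι X n x) :=
  (exists_normalized_freeDiff X x).choose_spec

lemma normalizedSection_zero (n : ℕ) :
    normalizedSection X (0 : (normalized.obj X).X n) = 0 :=
  normalizedι_injective _ (by rw [normalizedι_normalizedSection, map_zero, map_zero, freeDiff_zero])

lemma d_normalizedSection (m n : ℕ) (x : (normalized.obj X).X m) :
    (normalized.obj (free.obj (toSSet.obj X))).d m n (normalizedSection X x) =
      normalizedSection X ((normalized.obj X).d m n x) := by
  by_cases h : n + 1 = m
  · obtain rfl := h
    apply normalizedι_injective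
    rw [normalizedι_d, normalizedι_normalizedSection, normalizedι_normalizedSection, normalizedι_d]
    exact map_freeDiff X _ _
  · rw [HomologicalComplex.shape _ _ _ h, HomologicalComplex.shape _ _ _ h]
    exact (normalizedSection_zero _ _).symm

variable {X} in
lemma map_normalizedSection {n : ℕ} (x : (normalized.obj X).X n) :
    (normalized.map (free.map (toSSet.map f))).f n (normalizedSection X x) =
      normalizedSection Y ((normalized.map f).f n x) := by
  apply normalizedι_injective
  rw [normalizedι_naturality, normalizedι_normalizedSection, normalizedι_normalizedSection,
    normalizedι_naturality, free_map_freeDiff]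

lemma counit_normalizedSection {n : ℕ} (x : (normalized.obj X).X n) :
    (normalized.map (freeAdj.counit.app X)).f n (normalizedSection X x) = x := by
  apply normalizedι_injective
  exact (normalizedι_naturality _ _ _).trans
    ((congr_arg _ (normalizedι_normalizedSection X x)).trans (counit_freeDiff X _))

end

lemma map_d_apply {K L : ChQ.{u}} (φ : K ⟶ L) (m n : ℕ) (x : K.X m) :
    φ.f n (K.d m n x) = L.d m n (φ.f m x) :=
  (ConcreteCategory.congr_hom (φ.comm m n) x).symm

/-- The counit of the free-forgetful adjunction exhibits, non-additively, the homology of a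
simplicial module as a retract of the homology of the free simplicial module. -/
lemma transported_of_weq (hf : kanQuillen.weq (toSSet.map f)) : transported.weq f := by
  have hε (n : ℕ) (z) : (normalized.map (freeAdj.counit.app Y)).f n
      ((normalized.map (free.map (toSSet.map f))).f n z) =
      (normalized.map f).f n ((normalized.map (freeAdj.counit.app X)).f n z) := by
    have h := congr_arg (fun φ ↦ (normalized.map φ).f n) (freeAdj.counit.naturality f)
    rw [normalized.map_comp, normalized.map_comp] at h
    exact ConcreteCategory.congr_hom h z
  have h := (ModuleCatComplex.quasiIso_iff_forall _).1 (transported_weq_free _ hf)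
  refine (ModuleCatComplex.quasiIso_iff_forall (normalized.map f)).2 (fun n ↦
    ⟨fun x hx ⟨m, w, hw⟩ ↦ ?_, fun y hy ↦ ?_⟩)
  · obtain ⟨m', v, hv⟩ := (h n).1 (normalizedSection X x)
      (fun m ↦ by rw [d_normalizedSection, hx, normalizedSection_zero])
      ⟨m, normalizedSection Y w, by rw [map_normalizedSection, d_normalizedSection, hw]⟩
    refine ⟨m', (normalized.map (freeAdj.counit.app X)).f m' v, ?_⟩
    rw [← map_d_apply]
    exact (counit_normalizedSection X x).symm.trans (congr_arg _ hv)
  -- Surjectivity likewise: the section of `y` is homologous to the image of a cycle `z`, and the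
  -- counit is additive.
  · obtain ⟨z, hz, m, w, hw⟩ := (h n).2 (normalizedSection Y y)
      (fun m ↦ by rw [d_normalizedSection, hy, normalizedSection_zero])
    refine ⟨(normalized.map (freeAdj.counit.app X)).f n z, fun m ↦ ?_, m,
      (normalized.map (freeAdj.counit.app Y)).f m w, ?_⟩
    · rw [← map_d_apply]
      exact (congr_arg _ (hz m)).trans (map_zero _)
    · rw [← map_d_apply, ← hε]
      exact (counit_normalizedSection Y y).symm.trans ((congr_arg _ hw).trans (map_add _ _ _))

lemma simplicialQModModel_eq_transported : simplicialQModModel.{u} = transported.{u} := by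
  have hw : (kanQuillen.{u}).weq.inverseImage toSSet = transported.{u}.weq := by
    ext X Y f
    exact ⟨transported_of_weq f, weq_of_transported f⟩
  have hf : (kanQuillen.{u}).fib.inverseImage toSSet = transported.{u}.fib := by
    ext X Y f
    exact (transported_fib_iff f).symm
  refine ModelClasses.ext hw ?_ hf
  rw [← transported_isFunctorialModel.cof_eq_llp, ← hw, ← hf]
  rfl

end SimplicialQMod

lemma simplicialQModModel_isFunctorialModel : simplicialQModModel.{u}.IsFunctorialModel := by
  rw [SimplicialQMod.simplicialQModModel_eq_transported]
  exact SimplicialQMod.transported_isFunctorialModel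

/-! ### Lifting against fixed points, after a functor preserving them. -/

namespace GObj

section

variable {G : Type w} [Group G] [Finite G] (H : Subgroup G)
  {C : Type u'} [Category.{v'} C] [HasFiniteLimits C] {D : Type*} [Category* D] (F : C ⥤ D)
  [PreservesLimitsOfShape (SingleObj H) F]

/-- The image of the fixed points under a functor that preserves them is a limit. -/
noncomputable def isLimitMapFixedPoints (X : GObj G C) :
    IsLimit (F.mapCone (limit.cone (H.subtype.toFunctor ⋙ X))) :=
  isLimitOfPreserves F (limit.isLimit _)

variable {F H} in
lemma map_fixedPoints_hom_ext {X : GObj G C} {Z : D} {a b : Z ⟶ F.obj ((fixedPoints C H).obj X)}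
    (h : a ≫ F.map (fixedPointsι H X) = b ≫ F.map (fixedPointsι H X)) : a = b :=
  (isLimitMapFixedPoints H F X).hom_ext (fun _ ↦ h)

lemma exists_map_fixedPoints_lift {X : GObj G C} {Z : D}
    (t : Z ⟶ F.obj ((underlying G C).obj X)) (ht : ∀ h ∈ H, t ≫ F.map (act X h) = t) :
    ∃ s : Z ⟶ F.obj ((fixedPoints C H).obj X), s ≫ F.map (fixedPointsι H X) = t :=
  ⟨(isLimitMapFixedPoints H F X).lift
    ⟨Z, SingleObj.natTrans (M := H) (F := (Functor.const _).obj Z)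
      (G := (H.subtype.toFunctor ⋙ X) ⋙ F) t
      (fun h ↦ (Category.id_comp t).trans (ht h h.2).symm)⟩, (isLimitMapFixedPoints H F X).fac _ _⟩

/-- Lifting properties of maps of fixed points, in terms of invariant morphisms. -/
lemma hasLiftingProperty_map_fixedPoints_iff {E B : GObj G C} (p : E ⟶ B) {A K : D} (i : A ⟶ K) :
    HasLiftingProperty i (F.map ((fixedPoints C H).map p)) ↔
      ∀ (t : A ⟶ F.obj ((underlying G C).obj E)) (b : K ⟶ F.obj ((underlying G C).obj B)),
        (∀ h ∈ H, t ≫ F.map (act E h) = t) → (∀ h ∈ H, b ≫ F.map (act B h) = b) →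
        t ≫ F.map ((underlying G C).map p) = i ≫ b →
        ∃ l : K ⟶ F.obj ((underlying G C).obj E), (∀ h ∈ H, l ≫ F.map (act E h) = l) ∧
          i ≫ l = t ∧ l ≫ F.map ((underlying G C).map p) = b := by
  have hp : F.map ((fixedPoints C H).map p) ≫ F.map (fixedPointsι H B) =
      F.map (fixedPointsι H E) ≫ F.map ((underlying G C).map p) := by
    rw [← F.map_comp, ← F.map_comp, fixedPointsι_naturality]
  have hι (X : GObj G C) (h : G) (hh : h ∈ H) :
      F.map (fixedPointsι H X) ≫ F.map (act X h) = F.map (fixedPointsι H X) := by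
    rw [← F.map_comp]
    exact congr_arg F.map (fixedPointsι_act H X ⟨h, hh⟩)
  refine ⟨fun _ t b ht hb w ↦ ?_, fun h ↦ ⟨fun {t b} sq ↦ ?_⟩⟩
  · obtain ⟨t, rfl⟩ := exists_map_fixedPoints_lift H F t ht
    obtain ⟨b, rfl⟩ := exists_map_fixedPoints_lift H F b hb
    have sq : CommSq t i (F.map ((fixedPoints C H).map p)) b :=
      ⟨map_fixedPoints_hom_ext (by rw [Category.assoc, hp, ← Category.assoc, w, Category.assoc])⟩
    refine ⟨sq.lift ≫ F.map (fixedPointsι H E), fun h hh ↦ ?_, ?_, ?_⟩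
    · rw [Category.assoc, hι E h hh]
    · rw [← Category.assoc, sq.fac_left]
    · rw [Category.assoc, ← hp, ← Category.assoc, sq.fac_right]
  · obtain ⟨l, hl, h₁, h₂⟩ := h (t ≫ F.map (fixedPointsι H E)) (b ≫ F.map (fixedPointsι H B))
      (fun h hh ↦ by rw [Category.assoc, hι E h hh]) (fun h hh ↦ by rw [Category.assoc, hι B h hh])
      (by rw [Category.assoc, ← hp, ← Category.assoc, sq.w, Category.assoc])
    obtain ⟨l, rfl⟩ := exists_map_fixedPoints_lift H F l hl
    exact ⟨⟨⟨l, map_fixedPoints_hom_ext (by rw [Category.assoc, h₁]),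
      map_fixedPoints_hom_ext (by rw [Category.assoc, hp, ← Category.assoc, h₂])⟩⟩⟩

end

end GObj

/-! ### Genuine acyclic fibrations of based simplicial `G`-sets. -/

namespace PointedSSet

open SSet Simplicial Opposite

variable {G : Type w} [Group G] [Finite G]

lemma genuine_acyclic_fib_iff {E B : GObj G PointedSSet.{u}} (p : E ⟶ B) :
    (pointedSSetModel.{u}.genuineWeq G ⊓ pointedSSetModel.{u}.genuineFib G) p ↔
      ∀ H : Subgroup G, (MorphismProperty.monomorphisms SSet.{u}).rlp
        ((Under.forget _).map ((GObj.fixedPoints _ H).map p)) := by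
  rw [← kanQuillen_weq_inf_fib]
  exact ⟨fun h H ↦ ⟨h.1 H, h.2 H⟩, fun h ↦ ⟨fun H ↦ (h H).1, fun H ↦ (h H).2⟩⟩

/-! ### Genuine cofibrations are monomorphisms -/

section

variable (d : SimplexCategoryᵒᵖ)

/-- The set of simplices of given dimension. -/
abbrev simplices : SSet.{u} ⥤ Type u := (evaluation.{0, u, 0, u + 1} SimplexCategoryᵒᵖ (Type u)).obj d

/-- The simplicial set coinduced from a set of simplices of given dimension. -/
noncomputable abbrev cosimplices : Type u ⥤ SSet.{u} :=
  evaluationRightAdjoint.{0, u, 0, u + 1} (Type u) d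

/-- The adjunction between evaluation in one degree and its right adjoint. -/
noncomputable abbrev evAdj : simplices.{u} d ⊣ cosimplices d :=
  evaluationAdjunctionLeft.{0, u, 0, u + 1} (Type u) d

/-- The based simplicial set coinduced from the simplices of given dimension. -/
noncomputable def coinduced : PointedSSet.{u} ⥤ PointedSSet.{u} where
  obj A := Under.mk (A.hom ≫ (evAdj d).unit.app A.right)
  map φ := Under.homMk ((cosimplices d).map (φ.right.app d)) (by
    dsimp
    rw [Category.assoc, ← Under.w φ, Category.assoc]
    exact congr_arg _ ((evAdj d).unit.naturality φ.right).symm)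
  map_id A := by
    ext1
    exact (cosimplices d).map_id _
  map_comp φ ψ := by
    ext1
    exact (cosimplices d).map_comp _ _

/-- The natural map to the coinduced based simplicial set. -/
noncomputable def toCoinduced : 𝟭 PointedSSet.{u} ⟶ coinduced d where
  app A := Under.homMk ((evAdj d).unit.app A.right)
  naturality A B φ := by
    ext1
    exact (evAdj d).unit.naturality φ.right

lemma injective_toCoinduced (A : PointedSSet.{u}) :
    Function.Injective (((toCoinduced d).app A).right.app d) :=
  Function.HasLeftInverse.injective ⟨(evAdj d).counit.app _, fun x ↦
    ConcreteCategory.congr_hom ((evAdj d).left_triangle_components A.right) x⟩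

/-- The terminal `G`-object. -/
def point (G : Type w) [Group G] : GObj G PointedSSet.{u} := (Functor.const _).obj (Under.mk (𝟙 _))

/-- The map to the terminal `G`-object. -/
def toPoint (Z : GObj G PointedSSet.{u}) : Z ⟶ point G :=
  GObj.homMk (X := Z) (Y := point G)
    (Under.homMk (stdSimplex.isTerminalObj₀.from _) (stdSimplex.isTerminalObj₀.hom_ext _ _))
    (fun g ↦ by ext1; exact stdSimplex.isTerminalObj₀.hom_ext _ _)

omit [Finite G] in
lemma toPoint_unique {Z : GObj G PointedSSet.{u}} (a b : Z ⟶ point G) : a = b := by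
  apply (GObj.underlying G _).map_injective
  ext1
  exact stdSimplex.isTerminalObj₀.hom_ext _ _

/-- The basepoint of a based simplicial `G`-set, in a given dimension. -/
def pt (X : GObj G PointedSSet.{u}) : ((GObj.underlying G _).obj X).right.obj d :=
  ((GObj.underlying G _).obj X).hom.app d (stdSimplex.const 0 0 d)

/-- By adjunction, an `H`-invariant map from `K` to the coinduced object is a map from `K.obj d` to
the `H`-fixed `d`-simplices. Such a map extends from `A` to `K` by the basepoint, which the group
fixes. -/
lemma genuine_acyclic_fib_coinduced (X : GObj G PointedSSet.{u})
    (p : X ⋙ coinduced d ⟶ point G) :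
    (pointedSSetModel.{u}.genuineWeq G ⊓ pointedSSetModel.{u}.genuineFib G) p := by
  rw [genuine_acyclic_fib_iff]
  intro H A K i (_ : Mono i)
  rw [GObj.hasLiftingProperty_map_fixedPoints_iff]
  intro t b ht _ _
  let S := ((GObj.underlying G _).obj X).right
  have hi : Function.Injective (i.app d) := (mono_iff_injective _).1 inferInstance
  let t' : A.obj d → S.obj d := ((evAdj d).homEquiv A (S.obj d)).symm t
  have ht' (h : G) (hh : h ∈ H) (a : A.obj d) :
      (GObj.act X h).right.app d (t' a) = t' a := by
    have := ((evAdj d).homEquiv_naturality_right_symm t ((GObj.act X h).right.app d))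
    refine (ConcreteCategory.congr_hom this a).symm.trans ?_
    exact congr_arg (fun s ↦ ((evAdj d).homEquiv A (S.obj d)).symm s a) (ht h hh)
  have hpt (h : G) : (GObj.act X h).right.app d (pt d X) = pt d X :=
    ConcreteCategory.congr_hom (NatTrans.congr_app (Under.w (GObj.act X h)) d) _
  let e : K.obj d → S.obj d := Function.extend (i.app d) t' (fun _ ↦ pt d X)
  have he (a) : e (i.app d a) = t' a := hi.extend_apply _ _ a
  have he' (k) (hk : ¬ ∃ a, i.app d a = k) : e k = pt d X := Function.extend_apply' _ _ _ hk
  let l' : K.obj d ⟶ S.obj d := ↾e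
  have hl' (h : G) (hh : h ∈ H) : l' ≫ (GObj.act X h).right.app d = l' := by
    refine ConcreteCategory.hom_ext _ _ (fun k ↦ (?_ : (GObj.act X h).right.app d (e k) = e k))
    by_cases hk : ∃ a, i.app d a = k
    · obtain ⟨a, rfl⟩ := hk
      rw [he, ht' h hh]
    · rw [he' k hk, hpt h]
  refine ⟨(evAdj d).homEquiv K (S.obj d) l', fun h hh ↦ ?_, ?_, stdSimplex.isTerminalObj₀.hom_ext _ _⟩
  · exact ((evAdj d).homEquiv_naturality_right l' ((GObj.act X h).right.app d)).symm.trans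
      (congr_arg _ (hl' h hh))
  · exact ((evAdj d).homEquiv_naturality_left i l').symm.trans
      (((evAdj d).homEquiv _ _).eq_symm_apply.1 (ConcreteCategory.hom_ext _ _ he))

/-- Lifting against the coinduced object makes the map from `X` to it factor through `f`; as this
map is injective in degree `d`, so is `f`. -/
lemma underlyingCof_of_genuineCof {X Y : GObj G PointedSSet.{u}} (f : X ⟶ Y)
    (hf : pointedSSetModel.{u}.genuineCof G f) : pointedSSetModel.{u}.underlyingCof G f := by
  have h (d : SimplexCategoryᵒᵖ) : Mono (((GObj.underlying G _).map f).right.app d) := by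
    have := hf _ (genuine_acyclic_fib_coinduced d X (toPoint _))
    have sq : CommSq (Functor.whiskerLeft X (toCoinduced d)) f (toPoint _) (toPoint _) :=
      ⟨toPoint_unique _ _⟩
    have fac : ((GObj.underlying G _).map f).right ≫ ((GObj.underlying G _).map sq.lift).right =
        ((toCoinduced d).app ((GObj.underlying G _).obj X)).right :=
      congr_arg (fun φ : X ⟶ X ⋙ coinduced d ↦ ((GObj.underlying G _).map φ).right) sq.fac_left
    rw [mono_iff_injective]
    refine Function.Injective.of_comp (f := (((GObj.underlying G _).map sq.lift).right.app d)) ?_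
    intro x y hxy
    refine injective_toCoinduced d ((GObj.underlying G _).obj X) ?_
    rw [← fac]
    exact hxy
  exact @NatTrans.mono_of_mono_app _ _ _ _ _ _ _ h

end

end PointedSSet

/-! ### Equivariant lifting by extending partial lifts orbit by orbit. -/

namespace SSet.Subcomplex

lemma mem_sSup_obj {X : SSet.{u}} {c : Set X.Subcomplex} {m : SimplexCategoryᵒᵖ} {x : X.obj m} :
    x ∈ (sSup c).obj m ↔ ∃ Γ ∈ c, x ∈ Γ.obj m := by
  rw [Subfunctor.sSup_obj]
  exact Set.mem_sUnion.trans Set.exists_mem_image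

end SSet.Subcomplex

namespace GObj

open SSet Simplicial Opposite MonoidalCategory

variable {G : Type w} [Group G]

/-- The action of the group on the simplices of a simplicial `G`-set. -/
instance (Y : GObj G SSet.{u}) (m : SimplexCategoryᵒᵖ) :
    MulAction G (((underlying G SSet.{u}).obj Y).obj m) where
  smul g y := (act Y g).app m y
  one_smul y := ConcreteCategory.congr_hom (NatTrans.congr_app (act_one Y) m) y
  mul_smul g h y := ConcreteCategory.congr_hom (NatTrans.congr_app (act_mul Y g h) m) y

lemma map_smul (Y : GObj G SSet.{u}) (g : G) {m n : SimplexCategoryᵒᵖ} (φ : m ⟶ n)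
    (y : ((underlying G SSet.{u}).obj Y).obj m) :
    ((underlying G SSet.{u}).obj Y).map φ (g • y) =
      g • ((underlying G SSet.{u}).obj Y).map φ y :=
  (NatTrans.naturality_apply (act Y g) φ y).symm

lemma underlying_map_smul {X Y : GObj G SSet.{u}} (f : X ⟶ Y) (g : G) {m : SimplexCategoryᵒᵖ}
    (x : ((underlying G SSet.{u}).obj X).obj m) :
    ((underlying G SSet.{u}).map f).app m (g • x) =
      g • ((underlying G SSet.{u}).map f).app m x :=
  ConcreteCategory.congr_hom (NatTrans.congr_app (act_naturality f g) m) x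

lemma smul_mem_nonDegenerate (Y : GObj G SSet.{u}) (g : G) {n : ℕ}
    {y : ((underlying G SSet.{u}).obj Y) _⦋n⦌}
    (hy : y ∈ ((underlying G SSet.{u}).obj Y).nonDegenerate n) :
    g • y ∈ ((underlying G SSet.{u}).obj Y).nonDegenerate n := by
  rintro ⟨m, hm, f, z, hz⟩
  exact hy ⟨m, hm, f, g⁻¹ • z, by rw [map_smul, hz, inv_smul_smul]⟩

section

variable {Y E B : GObj G SSet.{u}} (p : E ⟶ B) (v : Y ⟶ B)

/-- The subcomplexes of a product that are graphs of equivariant partial lifts. -/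
structure IsPartialLift
    (Γ : ((underlying G SSet.{u}).obj Y ⊗ (underlying G SSet.{u}).obj E).Subcomplex) : Prop where
  smul_mem (g : G) {m} {y : ((underlying G SSet.{u}).obj Y).obj m}
    {e : ((underlying G SSet.{u}).obj E).obj m} (h : (y, e) ∈ Γ.obj m) : (g • y, g • e) ∈ Γ.obj m
  fac {m} {y : ((underlying G SSet.{u}).obj Y).obj m}
    {e : ((underlying G SSet.{u}).obj E).obj m} (h : (y, e) ∈ Γ.obj m) :
    ((underlying G SSet.{u}).map p).app m e = ((underlying G SSet.{u}).map v).app m y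
  unique {m} {y : ((underlying G SSet.{u}).obj Y).obj m}
    {e e' : ((underlying G SSet.{u}).obj E).obj m} (h : (y, e) ∈ Γ.obj m)
    (h' : (y, e') ∈ Γ.obj m) : e = e'

namespace IsPartialLift

variable {p v}

lemma sSup {c : Set ((underlying G SSet.{u}).obj Y ⊗ (underlying G SSet.{u}).obj E).Subcomplex}
    (hc : IsChain (· ≤ ·) c) (h : ∀ Γ ∈ c, IsPartialLift p v Γ) :
    IsPartialLift p v (sSup c) where
  smul_mem g m y e he := by
    obtain ⟨Γ, hΓ, he⟩ := SSet.Subcomplex.mem_sSup_obj.1 he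
    exact SSet.Subcomplex.mem_sSup_obj.2 ⟨Γ, hΓ, (h Γ hΓ).smul_mem g he⟩
  fac {m y e} he := by
    obtain ⟨Γ, hΓ, he⟩ := SSet.Subcomplex.mem_sSup_obj.1 he
    exact (h Γ hΓ).fac he
  unique {m y e e'} he he' := by
    obtain ⟨Γ, hΓ, he⟩ := SSet.Subcomplex.mem_sSup_obj.1 he
    obtain ⟨Γ', hΓ', he'⟩ := SSet.Subcomplex.mem_sSup_obj.1 he'
    obtain hle | hle := hc.total hΓ hΓ'
    · exact (h Γ' hΓ').unique (hle _ he) he'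
    · exact (h Γ hΓ).unique he (hle _ he')

variable {Γ : ((underlying G SSet.{u}).obj Y ⊗ (underlying G SSet.{u}).obj E).Subcomplex}

/-- The values of a partial lift on a simplicial set over its domain. -/
lemma exists_hom (h : IsPartialLift p v Γ) {A : SSet.{u}} (φ : A ⟶ (underlying G SSet.{u}).obj Y)
    (hφ : ∀ m (a : A.obj m), ∃ e, (φ.app m a, e) ∈ Γ.obj m) :
    ∃ t : A ⟶ (underlying G SSet.{u}).obj E, ∀ m (a : A.obj m), (φ.app m a, t.app m a) ∈ Γ.obj m := by
  choose t ht using hφ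
  refine ⟨{ app m := ↾(t m), naturality m n θ := ?_ }, ht⟩
  refine ConcreteCategory.hom_ext _ _ (fun a ↦ ?_)
  refine h.unique (ht n (A.map θ a)) ?_
  have := Γ.map θ (ht m a)
  rw [NatTrans.naturality_apply]
  exact this

lemma mem_iff_smul_mem (h : IsPartialLift p v Γ) (g : G) {m}
    {y : ((underlying G SSet.{u}).obj Y).obj m} {e : ((underlying G SSet.{u}).obj E).obj m} :
    (g • y, e) ∈ Γ.obj m ↔ (y, g⁻¹ • e) ∈ Γ.obj m :=
  ⟨fun he ↦ by simpa only [inv_smul_smul] using h.smul_mem g⁻¹ he,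
    fun he ↦ by simpa only [smul_inv_smul] using h.smul_mem g he⟩

section

variable {n : ℕ} (ψ : Δ[n] ⟶ (underlying G SSet.{u}).obj Y)
  (l : Δ[n] ⟶ (underlying G SSet.{u}).obj E)

/-- The graph of the equivariant extension of a partial lift to the orbit of a simplex. -/
def extend (Γ : ((underlying G SSet.{u}).obj Y ⊗ (underlying G SSet.{u}).obj E).Subcomplex) :
    ((underlying G SSet.{u}).obj Y ⊗ (underlying G SSet.{u}).obj E).Subcomplex where
  obj m := {x | x ∈ Γ.obj m ∨ ∃ (g : G) (a : Δ[n].obj m), x = (g • ψ.app m a, g • l.app m a)}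
  map {m m'} θ := by
    rintro _ (hx | ⟨g, a, rfl⟩)
    · exact Or.inl (Γ.map θ hx)
    · refine Or.inr ⟨g, Δ[n].map θ a, ?_⟩
      rw [NatTrans.naturality_apply, NatTrans.naturality_apply, ← map_smul, ← map_smul]
      rfl

variable {ψ l}

/-- The issue is that the extension be single-valued. Boundary simplices are controlled by `Γ`,
interior ones are disjoint from its domain, and `hψ` handles coincidences between translates of
interior ones. -/
lemma isPartialLift_extend (h : IsPartialLift p v Γ)
    (hl : l ≫ (underlying G SSet.{u}).map p = ψ ≫ (underlying G SSet.{u}).map v)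
    (hΓ : ∀ {m} {a : Δ[n].obj m}, a ∈ ∂Δ[n].obj m → (ψ.app m a, l.app m a) ∈ Γ.obj m)
    (hΓ' : ∀ {m} {a : Δ[n].obj m}, a ∉ ∂Δ[n].obj m → ∀ e, (ψ.app m a, e) ∉ Γ.obj m)
    (hψ : ∀ {m} {a b : Δ[n].obj m}, a ∉ ∂Δ[n].obj m → b ∉ ∂Δ[n].obj m → ∀ g : G,
      g • ψ.app m a = ψ.app m b → g • l.app m a = l.app m b) :
    IsPartialLift p v (extend ψ l Γ) := by
  have h₁ {m} {a : Δ[n].obj m} {g : G} {e} (he : (g • ψ.app m a, e) ∈ Γ.obj m) :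
      g • l.app m a = e := by
    rw [h.mem_iff_smul_mem] at he
    rw [← eq_inv_smul_iff]
    by_cases ha : a ∈ ∂Δ[n].obj m
    · exact h.unique (hΓ ha) he
    · exact absurd he (hΓ' ha _)
  have h₂ {m} {a b : Δ[n].obj m} {g : G} (hab : g • ψ.app m a = ψ.app m b) :
      g • l.app m a = l.app m b := by
    by_cases hb : b ∈ ∂Δ[n].obj m
    · exact h₁ (by rw [hab]; exact hΓ hb)
    · by_cases ha : a ∈ ∂Δ[n].obj m
      · rw [← eq_inv_smul_iff, eq_comm]
        exact h₁ (by rw [inv_smul_eq_iff.2 hab.symm]; exact hΓ ha)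
      · exact hψ ha hb g hab
  refine ⟨?_, ?_, ?_⟩
  · rintro g m y e (he | ⟨g', a, he⟩)
    · exact Or.inl (h.smul_mem g he)
    · obtain ⟨rfl, rfl⟩ := Prod.mk.inj he
      exact Or.inr ⟨g * g', a, by rw [mul_smul, mul_smul]⟩
  · rintro m y e (he | ⟨g', a, he⟩)
    · exact h.fac he
    · obtain ⟨rfl, rfl⟩ := Prod.mk.inj he
      rw [underlying_map_smul, underlying_map_smul]
      exact congr_arg _ (ConcreteCategory.congr_hom (NatTrans.congr_app hl m) a)
  · rintro m y e e' (he | ⟨g, a, he⟩) (he' | ⟨g', a', he'⟩)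
    · exact h.unique he he'
    · obtain ⟨rfl, rfl⟩ := Prod.mk.inj he'
      exact (h₁ he).symm
    · obtain ⟨rfl, rfl⟩ := Prod.mk.inj he
      exact h₁ he'
    · obtain ⟨rfl, rfl⟩ := Prod.mk.inj he
      obtain ⟨hy, rfl⟩ := Prod.mk.inj he'
      rw [← inv_smul_eq_iff, ← mul_smul]
      refine h₂ ?_
      rw [mul_smul, inv_smul_eq_iff, hy]

end

/-- The property of having the right lifting property with respect to boundary inclusions on
fixed points, in terms of invariant morphisms. -/
def _root_.GObj.LiftsInvariantBoundaries (p : E ⟶ B) : Prop :=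
  ∀ (H : Subgroup G) (n : ℕ) (t : (∂Δ[n] : SSet.{u}) ⟶ (underlying G SSet.{u}).obj E)
    (b : Δ[n] ⟶ (underlying G SSet.{u}).obj B),
    (∀ h ∈ H, t ≫ act E h = t) → (∀ h ∈ H, b ≫ act B h = b) →
    t ≫ (underlying G SSet.{u}).map p = ∂Δ[n].ι ≫ b →
    ∃ l : Δ[n] ⟶ (underlying G SSet.{u}).obj E, (∀ h ∈ H, l ≫ act E h = l) ∧
      ∂Δ[n].ι ≫ l = t ∧ l ≫ (underlying G SSet.{u}).map p = b

/-- Simplices of the boundary are faces of lower dimension. -/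
lemma _root_.SSet.exists_fac_of_mem_boundary {n : ℕ} {m : SimplexCategoryᵒᵖ} {a : Δ[n].obj m}
    (ha : a ∈ (∂Δ[n] : (Δ[n] : SSet.{u}).Subcomplex).obj m) : ∃ (k : ℕ) (_ : k < n)
      (θ : m.unop ⟶ ⦋k⦌) (δ : ⦋k⦌ ⟶ ⦋n⦌), stdSimplex.objEquiv a = θ ≫ δ := by
  refine ⟨(image (stdSimplex.objEquiv a)).len, ?_, factorThruImage _, image.ι _,
    (image.fac _).symm⟩
  refine lt_of_le_of_ne (SimplexCategory.len_le_of_mono (image.ι (stdSimplex.objEquiv a)))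
    (fun h ↦ ha ?_)
  have : IsIso (image.ι (stdSimplex.objEquiv a)) := (SimplexCategory.isIso_iff_of_mono _).2 h
  have : Epi (stdSimplex.objEquiv a) := by
    rw [← image.fac (stdSimplex.objEquiv a)]
    infer_instance
  exact SimplexCategory.epi_iff_surjective.1 this

/-- A nonempty set of simplices contains one which is minimal, in the sense that its faces of lower
dimension do not belong to it. -/
lemma exists_minimal_notMem (hΓ : ∃ m, ∃ y : ((underlying G SSet.{u}).obj Y).obj m,
      ∀ e, (y, e) ∉ Γ.obj m) :
    ∃ (n : ℕ) (y : ((underlying G SSet.{u}).obj Y) _⦋n⦌), (∀ e, (y, e) ∉ Γ.obj (op ⦋n⦌)) ∧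
      ∀ k < n, ∀ z : ((underlying G SSet.{u}).obj Y) _⦋k⦌, ∃ e, (z, e) ∈ Γ.obj (op ⦋k⦌) := by
  classical
  have : ∃ n, ∃ y : ((underlying G SSet.{u}).obj Y) _⦋n⦌, ∀ e, (y, e) ∉ Γ.obj (op ⦋n⦌) := by
    obtain ⟨⟨m⟩, y, hy⟩ := hΓ
    induction m using SimplexCategory.rec with | _ n =>
    exact ⟨n, y, hy⟩
  obtain ⟨y, hy⟩ := Nat.find_spec this
  refine ⟨Nat.find this, y, hy, fun k hk z ↦ ?_⟩
  by_contra! hz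
  exact Nat.find_min this hk ⟨z, hz⟩

/-- A simplex `y` of least dimension outside the domain is nondegenerate with its boundary inside.
The values on the boundary are fixed by the stabilizer of `y`, so they extend over `y` invariantly
under it, and then over the orbit. -/
lemma exists_lt (h : IsPartialLift p v Γ) (hp : LiftsInvariantBoundaries p)
    (hΓ : ∃ m, ∃ y : ((underlying G SSet.{u}).obj Y).obj m, ∀ e, (y, e) ∉ Γ.obj m) :
    ∃ Γ', IsPartialLift p v Γ' ∧ Γ < Γ' := by
  obtain ⟨n, y, hy, hn⟩ := exists_minimal_notMem hΓ
  have hmap {m m' : SimplexCategoryᵒᵖ} {z : ((underlying G SSet.{u}).obj Y).obj m} (θ : m ⟶ m')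
      (hz : ∃ e, (z, e) ∈ Γ.obj m) :
      ∃ e, (((underlying G SSet.{u}).obj Y).map θ z, e) ∈ Γ.obj m' :=
    ⟨_, Γ.map θ hz.choose_spec⟩
  have hy' : y ∈ ((underlying G SSet.{u}).obj Y).nonDegenerate n := by
    rintro ⟨k, hk, θ, z, rfl⟩
    obtain ⟨e, he⟩ := hmap θ.op (hn k hk z)
    exact hy e he
  let ψ : Δ[n] ⟶ (underlying G SSet.{u}).obj Y := yonedaEquiv.symm y
  have hψ {m} (a : Δ[n].obj m) :
      ψ.app m a = ((underlying G SSet.{u}).obj Y).map (stdSimplex.objEquiv a).op y := rfl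
  obtain ⟨t, ht⟩ := h.exists_hom (∂Δ[n].ι ≫ ψ) (by
    rintro m ⟨a, ha⟩
    obtain ⟨k, hk, θ, δ, fac⟩ := exists_fac_of_mem_boundary ha
    obtain ⟨e, he⟩ := hmap θ.op (hn k hk (((underlying G SSet.{u}).obj Y).map δ.op y))
    refine ⟨e, ?_⟩
    have : (∂Δ[n].ι ≫ ψ).app m ⟨a, ha⟩ = ((underlying G SSet.{u}).obj Y).map θ.op
        (((underlying G SSet.{u}).obj Y).map δ.op y) := by
      refine (hψ a).trans ?_
      rw [fac, op_comp, Functor.map_comp_apply]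
    rw [this]
    exact he)
  have hψH (g : G) (hg : g ∈ MulAction.stabilizer G y) : ψ ≫ act Y g = ψ :=
    (yonedaEquiv_symm_comp y _).trans (congr_arg yonedaEquiv.symm hg)
  obtain ⟨l, hl, hlt, hlp⟩ := hp (MulAction.stabilizer G y) n t
    (ψ ≫ (underlying G SSet.{u}).map v) (by
      intro g hg
      refine NatTrans.ext (funext fun m ↦ ConcreteCategory.hom_ext _ _ fun a ↦ ?_)
      refine h.unique ?_ (ht m a)
      have := h.smul_mem g (ht m a)
      rw [show g • (∂Δ[n].ι ≫ ψ).app m a = (∂Δ[n].ι ≫ ψ).app m a from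
        ConcreteCategory.congr_hom (NatTrans.congr_app (hψH g hg) m) a.1] at this
      exact this) (by
      intro g hg
      rw [Category.assoc, ← act_naturality, ← Category.assoc, hψH g hg])
    (NatTrans.ext (funext fun m ↦ ConcreteCategory.hom_ext _ _ fun a ↦ h.fac (ht m a)))
  have hepi {m} {a : Δ[n].obj m} (ha : a ∉ ∂Δ[n].obj m) : Epi (stdSimplex.objEquiv a) :=
    SimplexCategory.epi_iff_surjective.2 (not_not.1 ha)
  refine ⟨extend ψ l Γ, h.isPartialLift_extend hlp ?_ ?_ ?_, ?_⟩
  · intro m a ha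
    have := ht m ⟨a, ha⟩
    rw [← hlt] at this
    exact this
  · intro m a ha e he
    -- A section of the surjection `a` recovers `y` from its degeneracy along `a`, so a value there
    -- would give one on `y`.
    have := hepi ha
    have := isSplitEpi_of_epi (stdSimplex.objEquiv a)
    obtain ⟨e, he⟩ := hmap (section_ (stdSimplex.objEquiv a)).op ⟨e, he⟩
    refine hy e ?_
    rw [hψ, ← Functor.map_comp_apply, ← op_comp, IsSplitEpi.id, op_id,
      Functor.map_id_apply] at he
    exact he
  · rintro ⟨m⟩ a b ha hb g hab
    induction m using SimplexCategory.rec with | _ k =>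
    have := hepi ha
    rw [hψ, hψ, ← map_smul] at hab
    -- By Eilenberg-Zilber uniqueness, equal degeneracies of the nondegenerate simplices `g • y` and
    -- `y` force `g • y = y` and `a = b`; then `g` stabilizes `y` and `l` is invariant under it.
    have hy₁ := unique_nonDegenerate_simplex _ _ (stdSimplex.objEquiv a)
      ⟨g • y, smul_mem_nonDegenerate Y g hy'⟩ rfl (stdSimplex.objEquiv b) ⟨y, hy'⟩ hab
    have hy₂ := unique_nonDegenerate_map _ _ (stdSimplex.objEquiv a)
      ⟨g • y, smul_mem_nonDegenerate Y g hy'⟩ rfl (stdSimplex.objEquiv b) ⟨y, hy'⟩ hab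
    obtain rfl := stdSimplex.objEquiv.injective hy₂
    exact ConcreteCategory.congr_hom (NatTrans.congr_app (hl g (Subtype.ext_iff.1 hy₁)) _) a
  · refine lt_iff_le_not_ge.2 ⟨fun m x hx ↦ Or.inl hx, fun hle ↦ ?_⟩
    have := hle _ (Or.inr ⟨1, yonedaEquiv (𝟙 Δ[n]), rfl⟩)
    rw [one_smul, one_smul] at this
    exact hy _ (by
      rw [show ψ.app _ (yonedaEquiv (𝟙 Δ[n])) = y from yonedaEquiv.apply_symm_apply y] at this
      exact this)

/-- A partial lift extends to a total one. -/
lemma exists_total (h : IsPartialLift p v Γ) (hp : LiftsInvariantBoundaries p) :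
    ∃ Γ', Γ ≤ Γ' ∧ IsPartialLift p v Γ' ∧
      ∀ m (y : ((underlying G SSet.{u}).obj Y).obj m), ∃ e, (y, e) ∈ Γ'.obj m := by
  obtain ⟨Γ', hle, hΓ'⟩ := zorn_le_nonempty₀ {Γ | IsPartialLift p v Γ}
    (fun c hc hc' _ _ ↦ ⟨SupSet.sSup c, sSup hc' hc, fun _ ↦ le_sSup⟩) Γ h
  refine ⟨Γ', hle, hΓ'.1, ?_⟩
  by_contra! hm
  obtain ⟨Γ'', h'', hlt⟩ := exists_lt hΓ'.1 hp hm
  exact hΓ'.not_gt h'' hlt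

end IsPartialLift

/-- Equivariant maps that are injective have the left lifting property with respect to the maps
with the right lifting property with respect to boundary inclusions on fixed points. -/
lemma hasLiftingProperty_of_mono {X : GObj G SSet.{u}} (f : X ⟶ Y)
    [Mono ((underlying G SSet.{u}).map f)] (hp : LiftsInvariantBoundaries p) :
    HasLiftingProperty f p where
  sq_hasLift {a v} sq := by
    have hinj (m) : Function.Injective (((underlying G SSet.{u}).map f).app m) :=
      (mono_iff_injective _).1 inferInstance
    -- The initial partial lift is the graph of `a` over the image of `f`, single-valued because `f`
    -- is injective.
    have h₀ : IsPartialLift p v (Subcomplex.range (CartesianMonoidalCategory.lift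
        ((underlying G SSet.{u}).map f) ((underlying G SSet.{u}).map a))) := by
      refine ⟨?_, ?_, ?_⟩
      · rintro g m _ _ ⟨x, hx⟩
        obtain ⟨rfl, rfl⟩ := Prod.mk.inj hx
        exact ⟨g • x, Prod.ext (underlying_map_smul f g x) (underlying_map_smul a g x)⟩
      · rintro m _ _ ⟨x, hx⟩
        obtain ⟨rfl, rfl⟩ := Prod.mk.inj hx
        exact ConcreteCategory.congr_hom (NatTrans.congr_app
          (congr_arg (fun φ : X ⟶ B ↦ (underlying G SSet.{u}).map φ) sq.w) m) x
      · rintro m _ _ _ ⟨x, hx⟩ ⟨x', hx'⟩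
        obtain ⟨rfl, rfl⟩ := Prod.mk.inj hx
        obtain ⟨hx, rfl⟩ := Prod.mk.inj hx'
        obtain rfl := hinj m hx
        rfl
    obtain ⟨Γ, hle, hΓ, htot⟩ := h₀.exists_total hp
    obtain ⟨l, hl⟩ := hΓ.exists_hom (𝟙 _) htot
    refine ⟨⟨⟨homMk l (fun g ↦ ?_), ?_, ?_⟩⟩⟩
    · exact NatTrans.ext (funext fun m ↦ ConcreteCategory.hom_ext _ _ fun y ↦
        hΓ.unique (hl m (g • y)) (hΓ.smul_mem g (hl m y)))
    · apply (underlying G _).map_injective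
      exact NatTrans.ext (funext fun m ↦ ConcreteCategory.hom_ext _ _ fun x ↦
        hΓ.unique (hl m _) (hle m ⟨x, rfl⟩))
    · apply (underlying G _).map_injective
      exact NatTrans.ext (funext fun m ↦ ConcreteCategory.hom_ext _ _ fun y ↦ hΓ.fac (hl m y))

end

end GObj

/-! ### Return to based simplicial sets, and conclusion. -/

namespace PointedSSet

open SSet Simplicial

variable {G : Type w} [Group G]

/-- Lifting properties of maps of based simplicial `G`-sets can be checked after forgetting the
basepoints. -/
lemma hasLiftingProperty_of_forget {X Y E B : GObj G PointedSSet.{u}} (f : X ⟶ Y) (p : E ⟶ B)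
    [HasLiftingProperty (Functor.whiskerRight f (Under.forget _))
      (Functor.whiskerRight p (Under.forget _))] : HasLiftingProperty f p where
  sq_hasLift {a v} sq := by
    have sq' : CommSq (Functor.whiskerRight a (Under.forget _))
        (Functor.whiskerRight f (Under.forget _)) (Functor.whiskerRight p (Under.forget _))
        (Functor.whiskerRight v (Under.forget _)) :=
      sq.map ((Functor.whiskeringRight (SingleObj G) _ _).obj (Under.forget _))
    have h₁ := congr_arg (fun φ : X ⋙ Under.forget _ ⟶ E ⋙ Under.forget _ ↦
      (GObj.underlying G _).map φ) sq'.fac_left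
    have h₂ := congr_arg (fun φ : Y ⋙ Under.forget _ ⟶ B ⋙ Under.forget _ ↦
      (GObj.underlying G _).map φ) sq'.fac_right
    refine ⟨⟨⟨GObj.homMk (Under.homMk ((GObj.underlying G SSet.{u}).map sq'.lift) ?_) (fun g ↦ ?_),
      ?_, ?_⟩⟩⟩
    -- The lift preserves basepoints automatically: the basepoint of `Y` comes from `X`, where the
    -- lift agrees with `a`.
    · rw [← Under.w ((GObj.underlying G _).map f)]
      exact (Category.assoc _ _ _).trans
        ((congr_arg _ h₁).trans (Under.w ((GObj.underlying G _).map a)))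
    · ext1
      exact GObj.act_naturality sq'.lift g
    · apply (GObj.underlying G _).map_injective
      ext1
      exact h₁
    · apply (GObj.underlying G _).map_injective
      ext1
      exact h₂

lemma underlyingCof_iff_genuineCof [Finite G] {X Y : GObj G PointedSSet.{u}} (f : X ⟶ Y) :
    pointedSSetModel.{u}.underlyingCof G f ↔ pointedSSetModel.{u}.genuineCof G f := by
  refine ⟨fun (hf : Mono _) E B p hp ↦ ?_, underlyingCof_of_genuineCof f⟩
  rw [genuine_acyclic_fib_iff] at hp
  have : Mono ((GObj.underlying G _).map (Functor.whiskerRight f (Under.forget _))) := hf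
  have : HasLiftingProperty (Functor.whiskerRight f (Under.forget _))
      (Functor.whiskerRight p (Under.forget _)) :=
    GObj.hasLiftingProperty_of_mono (p := Functor.whiskerRight p (Under.forget _))
      (Functor.whiskerRight f (Under.forget _)) (fun H n t b ↦
      (GObj.hasLiftingProperty_map_fixedPoints_iff H (Under.forget _) p ∂Δ[n].ι).1
        (hp H _ (inferInstanceAs (Mono _))) t b)
  exact hasLiftingProperty_of_forget f p

end PointedSSet

theorem mainTheorem9 (G : Type w) [Group G] [Finite G] :
    -- based simplicial sets
    (∀ (X Y : GObj G PointedSSet.{u}) (f : X ⟶ Y),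
      pointedSSetModel.underlyingCof G f ↔ pointedSSetModel.genuineCof G f) ∧
    -- simplicial rational modules
    (∀ (X Y : GObj G SimplicialQMod.{u}) (f : X ⟶ Y),
      (simplicialQModModel.underlyingCof G f ↔ simplicialQModModel.naiveCof G f) ∧
      (simplicialQModModel.naiveCof G f ↔ simplicialQModModel.genuineCof G f)) ∧
    -- non-negatively graded rational chain complexes
    (∀ (X Y : GObj G ChQ.{u}) (f : X ⟶ Y),
      (chQModel.underlyingCof G f ↔ chQModel.naiveCof G f) ∧
      (chQModel.naiveCof G f ↔ chQModel.genuineCof G f)) ∧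
    -- the blended, injective and naive model structures coincide in the two rational cases
    (simplicialQModModel.{u}.blended G = simplicialQModModel.{u}.injective G ∧
      simplicialQModModel.{u}.injective G = simplicialQModModel.{u}.naive G ∧
      (simplicialQModModel.{u}.naive G).IsModelStructure) ∧
    (chQModel.{u}.blended G = chQModel.{u}.injective G ∧
      chQModel.{u}.injective G = chQModel.{u}.naive G ∧
      (chQModel.{u}.naive G).IsModelStructure) := by
  have h₁ := simplicialQModModel_isFunctorialModel.{u}
  have h₂ := chQModel_isFunctorialModel.{u}
  refine ⟨fun X Y f ↦ ?_, fun X Y f ↦ ⟨?_, ?_⟩, fun X Y f ↦ ⟨?_, ?_⟩,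
    ⟨h₁.blended_eq_injective G, h₁.injective_eq_naive G, h₁.naive_isModelStructure G⟩,
    ⟨h₂.blended_eq_injective G, h₂.injective_eq_naive G, h₂.naive_isModelStructure G⟩⟩
  · exact PointedSSet.underlyingCof_iff_genuineCof f
  · rw [h₁.naiveCof_eq G]
  · rw [h₁.genuineCof_eq G]
  · rw [h₂.naiveCof_eq G]
  · rw [h₂.genuineCof_eq G]
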